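/- Setting. Let $G$ be a directed acyclic graph on $n$ nodes in which every node has at most $d$ parents, where $1\le d\le n/2$, and let each edge $j\to i$ carry a real weight $b_{ji}$ with $|b_{ji}|\ge b_{\min}$, where $0<b_{\min}\le 1$ is a known lower bound. Put $\tau(G)=1+\max_j\sum_{l:\,j\to l}b_{jl}^2$. Let $X^{(1)},\dots,X^{(m)}\in\mathbb R^n$ be independent samples of the model $X_i=\sum_{j\in\mathrm{pa}(i)}b_{ji}X_j+\varepsilon_i$ with independent $\varepsilon_i\sim\mathcal N(0,1)$. "Regress $X_i$ on $X_J$" means ordinary least squares without intercept on the $m$ samples, that is, choosing a coefficient vector $\hat\beta$ that minimizes $\frac1m\sum_{k}\bigl(X_i^{(k)}-\sum_{j\in J}\beta_jX_j^{(k)}\bigr)^2$; the minimum value is the mean squared error (MSE). Algorithm. Phase 1 (ordering): start with a list $T$ of all nodes $i$ with $\frac1m\sum_k (X_i^{(k)})^2\le 1+b_{\min}^2/2$. While $|T|<n$, run over the nodes $i\notin T$ and the sets $J\subseteq T$ with $|J|\le d$; if regressing $X_i$ on $X_J$ has MSE at most $1+b_{\min}^2/2$, append $i$ to $T$ (once).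 Phase 2 (parents), given an ordering $T$: for each node $i$ let $S$ be the set of nodes before $i$ in $T$. Run over the sets $J\subseteq S$ with $|J|=\min(|S|,d)$. The set $J$ passes if for no $K\subseteq S\setminus J$ with $|K|\le\min(|S|-|J|,d)$ the regression of $X_i$ on $X_{J\cup K}$ has a coefficient with $|\hat\beta_k|\ge b_{\min}/2$ for some $k\in K$. For the first $J$ that passes, regress $X_i$ on $X_J$ and return $\{j\in J:|\hat\beta_j|\ge b_{\min}/2\}$ as the parent set of $i$. Theorem. There is an absolute constant $C>0$ such that for all $n,d,m,G,b_{\min}$ and weights as above and all $\delta\in(0,1)$ the following holds. 1. If $m\ge C\,\frac{1}{b_{\min}^4}\bigl(d\log(n/d)+\log(1/\delta)\bigr)$, then with probability at least $1-\delta$ Phase 1, for every order in which its loops are run, terminates with a correct topological order of the nodes of $G$. 2. If $m\ge C\,\frac{\tau(G)}{b_{\min}^2}\bigl(d\log(n/d)+\log(1/\delta)\bigr)$, then with probability at least $1-\delta$ Phase 2, run on the same samples with any correct topological order $T$ (simultaneously for all such $T$) and for every order in which its loops are run, returns exactly the parent set $\mathrm{pa}(i)$ for every node $i$. In particular neither bound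 involves the condition number of the covariance matrix. -/

import Mathlib

open MeasureTheory ProbabilityTheory
open scoped BigOperators

/-- A directed acyclic graph on the nodes `Fin n` with a real weight for every ordered pair of
nodes. Only the weights `weight j i` of the edges `j → i` are ever used. -/
structure WeightedDAG (n : ℕ) where
  graph : Digraph (Fin n)
  acyclic : ∀ i, ¬ Relation.TransGen graph.Adj i i
  weight : Fin n → Fin n → ℝ

namespace WeightedDAG

variable {n : ℕ}

open Classical in
/-- The parents of the node `i`, that is, all `j` with `j → i`. -/
noncomputable def parents (G : WeightedDAG n) (i : Fin n) : Finset (Fin n) :=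
  Finset.univ.filter (fun j => G.graph.Adj j i)

open Classical in
/-- The children of the node `j`, that is, all `l` with `j → l`. -/
noncomputable def children (G : WeightedDAG n) (j : Fin n) : Finset (Fin n) :=
  Finset.univ.filter (fun l => G.graph.Adj j l)

/-- `τ(G) = 1 + max_j ∑_{l : j → l} b_{jl}²` -/
noncomputable def tau (G : WeightedDAG n) : ℝ :=
  1 + ⨆ j : Fin n, ∑ l ∈ G.children j, G.weight j l ^ 2

/-- `X k i` is the coordinate `i` of the sample `k`. The `m` samples are independent draws of the
linear Gaussian structural equation model of `G` with noise variance one: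
`X_i = ∑_{j ∈ pa(i)} b_{ji} X_j + ε_i`, with all the noise variables of all the samples
independent standard Gaussians. -/
def IsSample (G : WeightedDAG n) {m : ℕ} {Ω : Type*} [MeasurableSpace Ω] (P : Measure Ω)
    (X : Fin m → Fin n → Ω → ℝ) : Prop :=
  ∃ ε : Fin m → Fin n → Ω → ℝ,
    iIndepFun (fun p : Fin m × Fin n => ε p.1 p.2) P ∧
    (∀ k i, HasLaw (ε k i) (gaussianReal 0 1) P) ∧
    ∀ᵐ ω ∂P, ∀ k i, X k i ω = (∑ j ∈ G.parents i, G.weight j i * X k j ω) + ε k i ω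

/-- The list `T` enumerates all the nodes, each once, and every edge goes from an earlier to a
later position. -/
def IsTopologicalOrder (G : WeightedDAG n) (T : List (Fin n)) : Prop :=
  T.Nodup ∧ (∀ i, i ∈ T) ∧ ∀ i j, G.graph.Adj i j → T.idxOf i < T.idxOf j

end WeightedDAG

namespace ExhaustiveRegression

variable {m n : ℕ}

/-- Empirical mean squared error of predicting `X_i` by `∑ j, β_j X_j`, for the data `D`
(sample index first, then the node). -/
noncomputable def mse (D : Fin m → Fin n → ℝ) (i : Fin n) (β : Fin n → ℝ) : ℝ :=
  (1 / (m : ℝ)) * ∑ k, (D k i - ∑ j, β j * D k j) ^ 2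

/-- `β` is a least squares solution for regressing `X_i` on `X_J` (without intercept). It is
recorded as a vector indexed by all the nodes which vanishes off `J`. -/
def IsLeastSquares (D : Fin m → Fin n → ℝ) (i : Fin n) (J : Finset (Fin n))
    (β : Fin n → ℝ) : Prop :=
  (∀ j, j ∉ J → β j = 0) ∧
    ∀ γ : Fin n → ℝ, (∀ j, j ∉ J → γ j = 0) → mse D i β ≤ mse D i γ

theorem exists_isLeastSquares (D : Fin m → Fin n → ℝ) (i : Fin n) (J : Finset (Fin n)) :
    ∃ β, IsLeastSquares D i J β := by
  let L : (Fin n → ℝ) →ₗ[ℝ] EuclideanSpace ℝ (Fin m) :=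
    { toFun := fun β => WithLp.toLp 2 (fun k => ∑ j, β j * D k j)
      map_add' := by
        intro β γ
        ext k
        simp [add_mul, Finset.sum_add_distrib]
      map_smul' := by
        intro c β
        ext k
        simp [Finset.mul_sum, mul_assoc] }
  let S : Submodule ℝ (Fin n → ℝ) :=
    { carrier := {β | ∀ j, j ∉ J → β j = 0}
      add_mem' := by
        intro β γ hβ hγ j hj
        simp [hβ j hj, hγ j hj]
      zero_mem' := by
        intro j _
        rfl
      smul_mem' := by
        intro c β hβ j hj
        simp [hβ j hj] }
  let y : EuclideanSpace ℝ (Fin m) := WithLp.toLp 2 (fun k => D k i)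
  have key : ∀ β, mse D i β = (1 / (m : ℝ)) * ‖y - L β‖ ^ 2 := by
    intro β
    rw [EuclideanSpace.norm_sq_eq]
    simp [mse, y, L]
  obtain ⟨v, ⟨β, hβ, rfl⟩, hv⟩ :=
    Submodule.exists_norm_eq_iInf_of_complete_subspace (S.map L)
      (Submodule.complete_of_finiteDimensional _) y
  refine ⟨β, hβ, fun γ hγ => ?_⟩
  rw [key, key]
  have h : ‖y - L β‖ ≤ ‖y - L γ‖ := by
    rw [hv]
    exact ciInf_le (f := fun w : S.map L => ‖y - (w : EuclideanSpace ℝ (Fin m))‖)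
      ⟨0, by rintro _ ⟨w, rfl⟩; exact norm_nonneg _⟩ ⟨L γ, γ, hγ, rfl⟩
  gcongr

/-- The result of the ordinary least squares regression of `X_i` on `X_J`: a minimizer of the
empirical squared error (which is unique whenever the columns of `X_J` are linearly
independent). -/
noncomputable def ols (D : Fin m → Fin n → ℝ) (i : Fin n) (J : Finset (Fin n)) : Fin n → ℝ :=
  Classical.choose (exists_isLeastSquares D i J)

theorem ols_isLeastSquares (D : Fin m → Fin n → ℝ) (i : Fin n) (J : Finset (Fin n)) :
    IsLeastSquares D i J (ols D i J) :=
  Classical.choose_spec (exists_isLeastSquares D i J)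

/-- The empirical variance of the (centred) variable `X_i`. -/
noncomputable def empVar (D : Fin m → Fin n → ℝ) (i : Fin n) : ℝ :=
  (1 / (m : ℝ)) * ∑ k, D k i ^ 2

/-- First phase, initialization: the list contains, in any order, exactly the nodes with
empirical variance at most `1 + b² / 2`. -/
def Phase1Init (D : Fin m → Fin n → ℝ) (b : ℝ) (T : List (Fin n)) : Prop :=
  T.Nodup ∧ ∀ i, i ∈ T ↔ empVar D i ≤ 1 + b ^ 2 / 2

/-- First phase, one step: a node `i` which is not yet listed is appended, because its regression
on some set `J` of at most `d` listed nodes has mean squared error at most `1 + b² / 2`. -/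
def Phase1Step (D : Fin m → Fin n → ℝ) (d : ℕ) (b : ℝ) (T T' : List (Fin n)) : Prop :=
  ∃ i, i ∉ T ∧
    (∃ J : Finset (Fin n), (∀ j ∈ J, j ∈ T) ∧ J.card ≤ d ∧
      mse D i (ols D i J) ≤ 1 + b ^ 2 / 2) ∧
    T' = T ++ [i]

/-- `T` is the current list at some moment of some run of the first phase. The order in which the
loops visit the nodes `i` and the sets `J` is left open, so every order is covered. -/
def Phase1Reachable (D : Fin m → Fin n → ℝ) (d : ℕ) (b : ℝ) (T : List (Fin n)) : Prop :=
  ∃ T₀, Phase1Init D b T₀ ∧ Relation.ReflTransGen (Phase1Step D d b) T₀ T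

/-- Whatever the order of the loops, the first phase never gets stuck before all nodes are
listed (hence halts, since each step lists one more node), and the list with which it halts is a
topological order. -/
def Phase1Succeeds (G : WeightedDAG n) (D : Fin m → Fin n → ℝ) (d : ℕ) (b : ℝ) : Prop :=
  ∀ T, Phase1Reachable D d b T →
    (T.length < n → ∃ T', Phase1Step D d b T T') ∧
    (T.length = n → G.IsTopologicalOrder T)

/-- The nodes before `i` in the list `T`. -/
def before (T : List (Fin n)) (i : Fin n) : Finset (Fin n) :=
  Finset.univ.filter (fun j => T.idxOf j < T.idxOf i)

/-- Second phase, the test of a candidate set `J` for the node `i` with predecessor set `S`: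
no regression of `X_i` on `X_{J ∪ K}`, with `K ⊆ S \ J` and `|K| ≤ min(|S| - |J|, d)`, has a
coefficient of absolute value at least `b / 2` at a node of `K`. -/
def Passes (D : Fin m → Fin n → ℝ) (d : ℕ) (b : ℝ) (S : Finset (Fin n)) (i : Fin n)
    (J : Finset (Fin n)) : Prop :=
  ∀ K : Finset (Fin n), K ⊆ S \ J → K.card ≤ min (S.card - J.card) d →
    ¬ ∃ k ∈ K, b / 2 ≤ |ols D i (J ∪ K) k|

open Classical in
/-- Second phase: `Q` is the parent set that is returned for the node `i` when the candidate sets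
`J ⊆ S`, `|J| = min(|S|, d)`, are visited in a suitable order: some `J` passes the test, and `Q`
consists of the nodes of `J` with a coefficient of absolute value at least `b / 2`. -/
def Phase2Output (D : Fin m → Fin n → ℝ) (d : ℕ) (b : ℝ) (T : List (Fin n)) (i : Fin n)
    (Q : Finset (Fin n)) : Prop :=
  ∃ J : Finset (Fin n), J ⊆ before T i ∧ J.card = min (before T i).card d ∧
    Passes D d b (before T i) i J ∧
    Q = J.filter (fun j => b / 2 ≤ |ols D i J j|)

/-- Whatever the order of the loops, the second phase, run with the ordering `T`, returns a
parent set for every node, and this is the correct one. -/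
def Phase2Succeeds (G : WeightedDAG n) (D : Fin m → Fin n → ℝ) (d : ℕ) (b : ℝ)
    (T : List (Fin n)) : Prop :=
  ∀ i, (∃ Q, Phase2Output D d b T i Q) ∧ ∀ Q, Phase2Output D d b T i Q → Q = G.parents i

end ExhaustiveRegression

/-! Write the data as X_i = Z a_i, where Z is the m × n matrix of standard Gaussian noise and a_i =
`G.effect i` is a fixed vector. If w is orthogonal to a fixed subspace V, then Zw is independent of
ZV. With exponentially small failure probability, Zw is therefore almost orthogonal to ZV
(`mulVec_projection_tail`), and the squared distance of Za from ZV is at least about m (w·a)²/|w|²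
(`mulVec_dist_tail`). Only an explicit witness w enters, never the covariance matrix, so no
condition number appears.

Phase 1: regression on the parents leaves at most the noise, with MSE close to 1. If an ancestrally
closed set misses i and a parent of i, a suitable missing parent q gives the witness e_i + b_{qi}
e_q, and the MSE is close to at least 1 + b_{qi}² (`exists_orthogonal_of_missing_parent`). The
threshold 1 + b²/2 separates the two cases.

Phase 2: e_i is orthogonal to the effects of all non-descendants of i, so the noise hardly
correlates with the regressors. The vectors `G.dual k` are biorthogonal to the effects and have
squared norm at most τ, which keeps every regressor at squared distance about m/τ or more from the
span of the others. Optimality of least squares then puts each coefficient within b/2 of the truth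
(`abs_ols_sub_trueCoeff_lt`).

All events are indexed by a node and a set of at most 2d nodes, so a union bound over exp(7 d
log(n/d)) pairs suffices; the rest is deterministic (`phase1Succeeds_of_mse`,
`phase2Succeeds_of_ols`). -/

/-! ### Standard Gaussian families and chi-squared tails. -/

/-- A family of independent standard Gaussian random variables. -/
structure IsStdGaussianFamily {ι Ω : Type*} [MeasurableSpace Ω] (P : Measure Ω)
    (ξ : ι → Ω → ℝ) : Prop where
  indep : iIndepFun ξ P
  law : ∀ i, HasLaw (ξ i) (gaussianReal 0 1) P

theorem mgf_sq_gaussianReal {l : ℝ} (hl : l < 1 / 2) :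
    mgf (fun x : ℝ => x ^ 2) (gaussianReal 0 1) l = (√(1 - 2 * l))⁻¹ := by
  rw [mgf, integral_gaussianReal_eq_integral_smul (by norm_num)]
  have h1 : ∀ x : ℝ, gaussianPDFReal 0 1 x • Real.exp (l * x ^ 2) =
      (√(2 * Real.pi))⁻¹ * Real.exp (-(1 / 2 - l) * x ^ 2) := by
    intro x
    rw [gaussianPDFReal, smul_eq_mul, mul_assoc, ← Real.exp_add]
    simp only [NNReal.coe_one, mul_one, sub_zero]
    congr 2
    ring
  simp_rw [h1]
  rw [integral_const_mul, integral_gaussian, ← Real.sqrt_inv, ← Real.sqrt_inv, ← Real.sqrt_mul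
    (by positivity)]
  congr 1
  have := Real.pi_pos
  have h2 : (1 : ℝ) - 2 * l ≠ 0 := by linarith
  have h3 : (1 / 2 : ℝ) - l ≠ 0 := by linarith
  field_simp

namespace IsStdGaussianFamily

variable {ι κ Ω : Type*} [MeasurableSpace Ω] {P : Measure Ω} {ξ : ι → Ω → ℝ}

theorem mgf_sq (h : IsStdGaussianFamily P ξ) (i : ι) {l : ℝ} (hl : l < 1 / 2) :
    mgf (fun ω => ξ i ω ^ 2) P l = (√(1 - 2 * l))⁻¹ := by
  rw [← mgf_sq_gaussianReal hl, ← (h.law i).map_eq, mgf_map (h.law i).aemeasurable (by fun_prop)]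
  rfl

theorem indep_sq (h : IsStdGaussianFamily P ξ) : iIndepFun (fun i ω => ξ i ω ^ 2) P :=
  h.indep.comp (fun _ x => x ^ 2) (by fun_prop)

theorem mgf_sum_sq [Fintype ι] (h : IsStdGaussianFamily P ξ) {l : ℝ} (hl : l < 1 / 2) :
    mgf (fun ω => ∑ i, ξ i ω ^ 2) P l =
      Real.exp (-(Fintype.card ι : ℝ) / 2 * Real.log (1 - 2 * l)) := by
  have h1 : (fun ω => ∑ i, ξ i ω ^ 2) = ∑ i, fun ω => ξ i ω ^ 2 := by
    ext ω; simp
  rw [h1, h.indep_sq.mgf_sum₀ (fun i => (h.law i).aemeasurable.pow_const 2)]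
  simp_rw [h.mgf_sq _ hl]
  have h2 : 0 < 1 - 2 * l := by linarith
  rw [Finset.prod_const, Finset.card_univ, Real.sqrt_eq_rpow, ← Real.rpow_neg h2.le,
    Real.rpow_def_of_pos h2, ← Real.exp_nat_mul]
  congr 1
  ring

theorem integrable_exp_mul_sum_sq [Fintype ι] (h : IsStdGaussianFamily P ξ) {l : ℝ}
    (hl : l < 1 / 2) : Integrable (fun ω => Real.exp (l * ∑ i, ξ i ω ^ 2)) P := by
  -- The mgf takes the default value 0 where the exponential is not integrable, whereas the formula
  -- for it is positive.
  by_contra hc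
  have h1 := mgf_undef hc
  rw [h.mgf_sum_sq hl] at h1
  exact (Real.exp_pos _).ne' h1

theorem le_sum_sq_le [Fintype ι] (h : IsStdGaussianFamily P ξ) {l : ℝ} (hl0 : 0 ≤ l)
    (hl : l < 1 / 2) (s : ℝ) :
    P.real {ω | s ≤ ∑ i, ξ i ω ^ 2} ≤
      Real.exp (-l * s - (Fintype.card ι : ℝ) / 2 * Real.log (1 - 2 * l)) := by
  have := h.indep.isProbabilityMeasure
  refine (measure_ge_le_exp_mul_mgf s hl0 (h.integrable_exp_mul_sum_sq hl)).trans_eq ?_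
  rw [h.mgf_sum_sq hl, ← Real.exp_add]
  congr 1
  ring

theorem sum_sq_le_le [Fintype ι] (h : IsStdGaussianFamily P ξ) {l : ℝ} (hl0 : l ≤ 0) (s : ℝ) :
    P.real {ω | ∑ i, ξ i ω ^ 2 ≤ s} ≤
      Real.exp (-l * s - (Fintype.card ι : ℝ) / 2 * Real.log (1 - 2 * l)) := by
  have := h.indep.isProbabilityMeasure
  have hl : l < 1 / 2 := by linarith
  refine (measure_le_le_exp_mul_mgf s hl0 (h.integrable_exp_mul_sum_sq hl)).trans_eq ?_
  rw [h.mgf_sum_sq hl, ← Real.exp_add]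
  congr 1
  ring

/-- Lower tail of the chi-squared distribution. -/
theorem chiSq_lower_tail [Fintype ι] (h : IsStdGaussianFamily P ξ) {t : ℝ} (ht : 0 ≤ t)  :
    P.real {ω | ∑ i, ξ i ω ^ 2 ≤ Fintype.card ι * (1 - t)} ≤
      Real.exp (-(Fintype.card ι * t ^ 2 / 4)) := by
  refine (h.sum_sq_le_le (l := -(t / 2)) (by linarith) _).trans ?_
  rw [Real.exp_le_exp]
  have h1 : t - t ^ 2 / 2 ≤ Real.log (1 - 2 * -(t / 2)) := by
    have h2 := Real.le_log_one_add_of_nonneg ht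
    rw [show 1 - 2 * -(t / 2) = 1 + t by ring]
    refine le_trans ?_ h2
    rw [le_div_iff₀ (by linarith)]
    nlinarith [pow_nonneg ht 3]
  have h3 : (0 : ℝ) ≤ Fintype.card ι := by positivity
  nlinarith [mul_le_mul_of_nonneg_left h1 h3]

/-- Upper tail of the chi-squared distribution, for small deviations. -/
theorem chiSq_upper_tail [Fintype ι] (h : IsStdGaussianFamily P ξ) {t : ℝ} (ht : 0 ≤ t)
    (ht1 : t ≤ 1) :
    P.real {ω | Fintype.card ι * (1 + t) ≤ ∑ i, ξ i ω ^ 2} ≤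
      Real.exp (-(Fintype.card ι * t ^ 2 / 16)) := by
  -- This l keeps 1 - 2l ≥ 3/4 for t ≤ 1, so the crude bound log x ≥ 1 - 1/x already gives the
  -- exponent t²/16.
  refine (h.le_sum_sq_le (l := t / 8) (by linarith) (by linarith) _).trans ?_
  rw [Real.exp_le_exp]
  have h1 : -(t / 4) - t ^ 2 / 8 ≤ Real.log (1 - 2 * (t / 8)) := by
    have h3 : (0 : ℝ) < 1 - 2 * (t / 8) := by linarith
    refine le_trans ?_ (Real.one_sub_inv_le_log_of_pos h3)
    have h4 : (1 - 2 * (t / 8))⁻¹ ≤ 1 + t / 4 + t ^ 2 / 8 := by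
      rw [inv_le_iff_one_le_mul₀ h3]
      nlinarith [mul_nonneg (pow_nonneg ht 2) (sub_nonneg.2 ht1)]
    linarith
  have h3 : (0 : ℝ) ≤ Fintype.card ι := by positivity
  nlinarith [mul_le_mul_of_nonneg_left h1 h3]

/-- Upper tail of the chi-squared distribution, for large deviations. -/
theorem chiSq_large_tail [Fintype ι] (h : IsStdGaussianFamily P ξ) {r : ℕ}
    (hr : Fintype.card ι ≤ r) (s : ℝ) :
    P.real {ω | s ≤ ∑ i, ξ i ω ^ 2} ≤ Real.exp (r / 2 - s / 4) := by
  refine (h.le_sum_sq_le (l := 1 / 4) (by norm_num) (by norm_num) _).trans ?_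
  rw [Real.exp_le_exp]
  have h1 : -1 ≤ Real.log (1 - 2 * (1 / 4)) := by
    have := Real.one_sub_inv_le_log_of_pos (x := 1 - 2 * (1 / 4)) (by norm_num)
    norm_num at this ⊢
    linarith
  have h2 : (Fintype.card ι : ℝ) ≤ r := by exact_mod_cast hr
  have h3 : (0 : ℝ) ≤ Fintype.card ι := by positivity
  nlinarith

theorem hasGaussianLaw [Finite ι] (h : IsStdGaussianFamily P ξ) :
    HasGaussianLaw (fun ω i => ξ i ω) P :=
  h.indep.hasGaussianLaw fun i => (h.law i).hasGaussianLaw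

/-- Linear images of a standard Gaussian family are jointly Gaussian. -/
theorem hasGaussianLaw_mulVec [Fintype ι] [Fintype κ] (h : IsStdGaussianFamily P ξ)
    (A : Matrix κ ι ℝ) : HasGaussianLaw (fun ω => A.mulVec (fun i => ξ i ω)) P :=
  h.hasGaussianLaw.map_fun (LinearMap.toContinuousLinearMap A.mulVecLin)

theorem covariance_dotProduct [Fintype ι] (h : IsStdGaussianFamily P ξ) (a b : ι → ℝ) :
    cov[fun ω => a ⬝ᵥ (fun i => ξ i ω), fun ω => b ⬝ᵥ (fun i => ξ i ω); P] = a ⬝ᵥ b := by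
  classical
  have := h.indep.isProbabilityMeasure
  have hL : ∀ i, MemLp (ξ i) 2 P := fun i => (h.law i).hasGaussianLaw.memLp_two
  simp only [dotProduct]
  rw [covariance_fun_sum_fun_sum (fun i => (hL i).const_mul _) (fun i => (hL i).const_mul _)]
  refine Finset.sum_congr rfl fun i _ => ?_
  rw [Finset.sum_eq_single i]
  · rw [covariance_const_mul_left, covariance_const_mul_right,
      covariance_self (h.law i).aemeasurable, (h.law i).variance_eq, variance_id_gaussianReal]
    simp
  · intro j _ hj
    rw [covariance_const_mul_left, covariance_const_mul_right,
      (h.indep.indepFun hj.symm).covariance_eq_zero (hL i) (hL j)]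
    simp
  · simp

/-- Linear combinations with orthonormal coefficient vectors of a standard Gaussian family form
again such a family. -/
theorem of_orthonormal [Fintype ι] [Fintype κ] [DecidableEq κ] (h : IsStdGaussianFamily P ξ)
    (A : Matrix κ ι ℝ) (hA : A * A.transpose = 1) :
    IsStdGaussianFamily P (fun k ω => A k ⬝ᵥ (fun i => ξ i ω)) := by
  have := h.indep.isProbabilityMeasure
  have hG := h.hasGaussianLaw_mulVec A
  have hij : ∀ i j, A i ⬝ᵥ A j = if i = j then 1 else 0 := by
    intro i j
    have := congrFun (congrFun hA i) j
    rwa [Matrix.one_apply] at this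
  constructor
  · refine HasGaussianLaw.iIndepFun_of_covariance_eq_zero hG ?_
    intro i j hne
    rw [h.covariance_dotProduct, hij, if_neg hne]
  · intro k
    have hk : HasGaussianLaw (fun ω => A k ⬝ᵥ (fun i => ξ i ω)) P := hG.eval k
    refine ⟨hk.aemeasurable, ?_⟩
    rw [hk.map_eq_gaussianReal]
    have h1 : ∫ ω, A k ⬝ᵥ (fun i => ξ i ω) ∂P = 0 := by
      simp only [dotProduct]
      rw [integral_finsetSum _ fun i _ => ((h.law i).hasGaussianLaw.integrable).const_mul _]
      refine Finset.sum_eq_zero fun i _ => ?_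
      rw [integral_const_mul, (h.law i).integral_eq]
      simp
    rw [h1, ← covariance_self hk.aemeasurable, h.covariance_dotProduct, hij]
    simp

/-- Linear combinations with orthogonal coefficient vectors of a standard Gaussian family are
independent. -/
theorem indepFun_of_orthogonal {κ' : Type*} [Fintype ι] [Fintype κ] [Fintype κ']
    (h : IsStdGaussianFamily P ξ) (A : Matrix κ ι ℝ) (B : Matrix κ' ι ℝ)
    (hAB : ∀ k k', A k ⬝ᵥ B k' = 0) :
    IndepFun (fun ω => A.mulVec (fun i => ξ i ω)) (fun ω => B.mulVec (fun i => ξ i ω)) P := by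
  have hG : HasGaussianLaw (fun ω => (A.mulVec (fun i => ξ i ω), B.mulVec (fun i => ξ i ω))) P :=
    h.hasGaussianLaw.map_fun
      ((LinearMap.toContinuousLinearMap A.mulVecLin).prod
        (LinearMap.toContinuousLinearMap B.mulVecLin))
  refine HasGaussianLaw.indepFun_of_covariance_eval
    (X := fun k ω => A.mulVec (fun i => ξ i ω) k)
    (Y := fun k ω => B.mulVec (fun i => ξ i ω) k) hG ?_
  intro k k'
  exact (h.covariance_dotProduct _ _).trans (hAB k k')

end IsStdGaussianFamily

/-! ### Projections of a Gaussian vector onto low-dimensional subspaces. -/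

namespace IsStdGaussianFamily

variable {ι κ Ω : Type*} [MeasurableSpace Ω] {P : Measure Ω} {ξ : ι → Ω → ℝ}

/-- The squared norm of the projection of a standard Gaussian vector onto the span of `r` fixed
vectors exceeds `s` with exponentially small probability. -/
theorem projection_tail [Fintype ι] [Fintype κ] (h : IsStdGaussianFamily P ξ) (Y : κ × ι → ℝ)
    {r : ℕ} (hr : Fintype.card κ ≤ r) (s : ℝ) :
    P.real {ω | ∃ β : κ → ℝ, s * ∑ i, (∑ k, β k * Y (k, i)) ^ 2 <
      (∑ i, (∑ k, β k * Y (k, i)) * ξ i ω) ^ 2} ≤ Real.exp (r / 2 - s / 4) := by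
  classical
  have := h.indep.isProbabilityMeasure
  let y : κ → EuclideanSpace ℝ ι := fun k => WithLp.toLp 2 (fun i => Y (k, i))
  let V : Submodule ℝ (EuclideanSpace ℝ ι) := Submodule.span ℝ (Set.range y)
  let u := stdOrthonormalBasis ℝ V
  let A : Matrix (Fin (Module.finrank ℝ V)) ι ℝ := fun j i => (u j : EuclideanSpace ℝ ι) i
  have hin : ∀ v w : EuclideanSpace ℝ ι, inner ℝ v w = ∑ i, v i * w i := by
    intro v w
    simp [PiLp.inner_apply, mul_comm]
  have hA : A * A.transpose = 1 := by
    ext j j'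
    rw [Matrix.mul_apply, Matrix.one_apply]
    have h1 := orthonormal_iff_ite.1 u.orthonormal j j'
    rw [Submodule.coe_inner, hin] at h1
    exact h1
  have hF := h.of_orthonormal A hA
  have hcard : Fintype.card (Fin (Module.finrank ℝ V)) ≤ r := by
    rw [Fintype.card_fin]
    exact (finrank_range_le_card y).trans hr
  refine le_trans (measureReal_mono ?_ (measure_ne_top _ _)) (hF.chiSq_large_tail hcard s)
  rintro ω ⟨β, hβ⟩
  let v : V := ⟨∑ k, β k • y k, Submodule.sum_mem _ fun k _ =>
    Submodule.smul_mem _ _ (Submodule.subset_span ⟨k, rfl⟩)⟩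
  have hv : ∀ i, (v : EuclideanSpace ℝ ι) i = ∑ k, β k * Y (k, i) := by
    intro i
    simp [v, y]
  have hv2 : ∀ i, (v : EuclideanSpace ℝ ι) i = ∑ j, u.repr v j * A j i := by
    intro i
    conv_lhs => rw [← u.sum_repr v]
    simp [A]
  have hn : ∑ i, (∑ k, β k * Y (k, i)) ^ 2 = ∑ j, u.repr v j ^ 2 := by
    have h1 := u.repr.inner_map_map v v
    rw [Submodule.coe_inner, hin] at h1
    simp only [PiLp.inner_apply] at h1
    simp only [← hv]
    simp only [sq]
    rw [← h1]
    simp [sq]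
  have hi : ∑ i, (∑ k, β k * Y (k, i)) * ξ i ω =
      ∑ j, u.repr v j * (A j ⬝ᵥ fun i => ξ i ω) := by
    simp only [← hv, hv2, dotProduct, Finset.sum_mul, Finset.mul_sum]
    rw [Finset.sum_comm]
    simp only [mul_assoc]
  rw [hn, hi] at hβ
  -- In orthonormal coordinates of the span, Cauchy–Schwarz bounds the quotient by a chi-squared sum
  -- with at most r terms.
  have hcs := Finset.sum_mul_sq_le_sq_mul_sq Finset.univ (fun j => u.repr v j)
    (fun j => A j ⬝ᵥ fun i => ξ i ω)
  have h0 : 0 ≤ ∑ j, u.repr v j ^ 2 := Finset.sum_nonneg fun _ _ => sq_nonneg _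
  by_contra hc
  have hc' : ∑ j, (A j ⬝ᵥ fun i => ξ i ω) ^ 2 < s := by
    simpa using hc
  have := mul_le_mul_of_nonneg_left hc'.le h0
  linarith

/-- The version of `projection_tail` for random vectors that are independent of the Gaussian
vector. -/
theorem projection_tail_of_indepFun [Fintype ι] [Fintype κ] (h : IsStdGaussianFamily P ξ)
    {Y : Ω → κ × ι → ℝ} (hY : AEMeasurable Y P) (hind : IndepFun (fun ω i => ξ i ω) Y P)
    {r : ℕ} (hr : Fintype.card κ ≤ r) (s : ℝ) :
    P.real {ω | ∃ β : κ → ℝ, s * ∑ i, (∑ k, β k * Y ω (k, i)) ^ 2 <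
      (∑ i, (∑ k, β k * Y ω (k, i)) * ξ i ω) ^ 2} ≤ Real.exp (r / 2 - s / 4) := by
  have := h.indep.isProbabilityMeasure
  let S : Set ((ι → ℝ) × (κ × ι → ℝ)) := {p | ∃ β : κ → ℝ,
    s * ∑ i, (∑ k, β k * p.2 (k, i)) ^ 2 < (∑ i, (∑ k, β k * p.2 (k, i)) * p.1 i) ^ 2}
  have hS : MeasurableSet S := by
    have : S = ⋃ β : κ → ℝ, {p | s * ∑ i, (∑ k, β k * p.2 (k, i)) ^ 2 <
        (∑ i, (∑ k, β k * p.2 (k, i)) * p.1 i) ^ 2} := by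
      ext p
      simp [S]
    rw [this]
    -- The union over β is uncountable, but each member is open.
    refine (isOpen_iUnion fun β => ?_).measurableSet
    exact isOpen_lt (by fun_prop) (by fun_prop)
  have hg : AEMeasurable (fun ω i => ξ i ω) P := h.hasGaussianLaw.aemeasurable
  have hmap := (indepFun_iff_map_prod_eq_prod_map_map hg hY).1 hind
  have hpg := Measure.isProbabilityMeasure_map hg
  have hpY := Measure.isProbabilityMeasure_map hY
  -- By independence the joint law is a product; Fubini freezes Y, and the bound for fixed vectors
  -- is uniform in them.
  have h1 : P {ω | ((fun i => ξ i ω), Y ω) ∈ S} ≤ ENNReal.ofReal (Real.exp (r / 2 - s / 4)) := by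
    have h2 := Measure.map_apply_of_aemeasurable (hg.prodMk hY) hS
    rw [hmap, Measure.prod_apply_symm hS] at h2
    change P ((fun ω => ((fun i => ξ i ω), Y ω)) ⁻¹' S) ≤ _
    rw [← h2]
    refine (lintegral_mono (g := fun _ => ENNReal.ofReal (Real.exp (r / 2 - s / 4)))
      fun y => ?_).trans (by simp)
    have h3 := h.projection_tail y hr s
    rw [Measure.map_apply_of_aemeasurable hg (measurable_prodMk_right hS)]
    rw [← ENNReal.ofReal_toReal (measure_ne_top P _)]
    exact ENNReal.ofReal_le_ofReal h3
  exact ENNReal.toReal_le_of_le_ofReal (Real.exp_pos _).le h1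

end IsStdGaussianFamily

/-! ### Gaussian matrices: images of orthogonal vectors and distances to subspaces. -/

section RandomMatrix

open Matrix

variable {M N Ω : Type*} [Fintype M] [Fintype N] [DecidableEq M]

/-- The vector indexed by the entries of a matrix whose row `k` is `w` and whose other rows
vanish. -/
def rowVector (k : M) (w : N → ℝ) : M × N → ℝ := fun p => if k = p.1 then w p.2 else 0

theorem rowVector_dotProduct (k : M) (w : N → ℝ) (v : M × N → ℝ) :
    rowVector k w ⬝ᵥ v = w ⬝ᵥ fun i => v (k, i) := by
  simp only [dotProduct, rowVector, Fintype.sum_prod_type, ite_mul, zero_mul]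
  rw [Finset.sum_eq_single k]
  · simp
  · intro k' _ hk
    simp [hk.symm]
  · simp

theorem rowVector_dotProduct_rowVector (k k' : M) (w w' : N → ℝ) :
    rowVector k w ⬝ᵥ rowVector k' w' = if k = k' then w ⬝ᵥ w' else 0 := by
  rw [rowVector_dotProduct]
  split_ifs with h
  · simp [rowVector, h]
  · simp [rowVector, Ne.symm h, dotProduct]

variable [MeasurableSpace Ω] {P : Measure Ω} {Z : Ω → Matrix M N ℝ}

/-- Each entry of Zw uses a different row of Z, so the coefficient vectors have disjoint supports
and are orthonormal. -/
theorem IsStdGaussianFamily.mulVec (h : IsStdGaussianFamily P fun (p : M × N) ω => Z ω p.1 p.2)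
    {w : N → ℝ} (hw : w ⬝ᵥ w = 1) : IsStdGaussianFamily P fun k ω => (Z ω *ᵥ w) k := by
  have h1 := h.of_orthonormal (Matrix.of fun k => rowVector k w) (by
    ext k k'
    rw [Matrix.one_apply, Matrix.mul_apply]
    have := rowVector_dotProduct_rowVector k k' w w
    rw [hw] at this
    exact this)
  have h2 : (fun k ω => (Z ω *ᵥ w) k) = fun k ω => (Matrix.of fun k => rowVector k w) k ⬝ᵥ
      fun p : M × N => Z ω p.1 p.2 := by
    ext k ω
    exact (dotProduct_comm _ _).trans
      (rowVector_dotProduct k w fun p : M × N => Z ω p.1 p.2).symm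
  rw [h2]
  exact h1

/-- The squared length of the projection of `Z w` onto the subspace `Z V`, for a standard Gaussian
matrix `Z` and a unit vector `w` orthogonal to `V`, is large with exponentially small
probability only. -/
theorem IsStdGaussianFamily.mulVec_projection_tail
    (h : IsStdGaussianFamily P fun (p : M × N) ω => Z ω p.1 p.2) {w : N → ℝ} (hw : w ⬝ᵥ w = 1)
    (V : Submodule ℝ (N → ℝ)) (hV : ∀ u ∈ V, w ⬝ᵥ u = 0) {r : ℕ} (hr : Module.finrank ℝ V ≤ r)
    (s : ℝ) :
    P.real {ω | ∃ u ∈ V, s * ((Z ω *ᵥ u) ⬝ᵥ (Z ω *ᵥ u)) < ((Z ω *ᵥ u) ⬝ᵥ (Z ω *ᵥ w)) ^ 2} ≤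
      Real.exp (r / 2 - s / 4) := by
  have := h.indep.isProbabilityMeasure
  let c := Module.finBasis ℝ V
  let A : Matrix M (M × N) ℝ := Matrix.of fun k => rowVector k w
  let B : Matrix (Fin (Module.finrank ℝ V) × M) (M × N) ℝ :=
    Matrix.of fun p => rowVector p.2 (c p.1 : N → ℝ)
  have hind := h.indepFun_of_orthogonal A B (by
    intro k p
    refine (rowVector_dotProduct_rowVector _ _ _ _).trans ?_
    rw [hV _ (c p.1).2, ite_self])
  have hA : ∀ ω, A *ᵥ (fun p : M × N => Z ω p.1 p.2) = Z ω *ᵥ w := by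
    intro ω
    ext k
    exact (rowVector_dotProduct k w _).trans (dotProduct_comm _ _)
  have hB : ∀ ω j k, (B *ᵥ fun p : M × N => Z ω p.1 p.2) (j, k) = (Z ω *ᵥ (c j : N → ℝ)) k := by
    intro ω j k
    exact (rowVector_dotProduct k _ _).trans (dotProduct_comm _ _)
  simp only [hA] at hind
  have hmain := (h.mulVec hw).projection_tail_of_indepFun
    (h.hasGaussianLaw_mulVec B).aemeasurable hind (r := r) (by simpa using hr) s
  refine le_trans (measureReal_mono ?_ (measure_ne_top _ _)) hmain
  rintro ω ⟨u, hu, hlt⟩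
  refine ⟨fun j => c.repr ⟨u, hu⟩ j, ?_⟩
  have hsum : ∀ k, ∑ j, c.repr ⟨u, hu⟩ j * (B *ᵥ fun p : M × N => Z ω p.1 p.2) (j, k) =
      (Z ω *ᵥ u) k := by
    intro k
    have h1 : u = ∑ j, c.repr ⟨u, hu⟩ j • (c j : N → ℝ) := by
      have h2 := congrArg (Submodule.subtype V) (c.sum_repr ⟨u, hu⟩)
      rw [map_sum] at h2
      exact h2.symm
    conv_rhs => rw [h1]
    rw [Matrix.mulVec_sum]
    simp [hB, Matrix.mulVec_smul]
  simp only [hsum]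
  simpa only [dotProduct, sq] using hlt

/-- The distance of `Z a` from the subspace `Z V`, for a standard Gaussian matrix `Z`, is bounded
below in terms of a vector `w` orthogonal to `V` that witnesses the distance of `a` from `V`. -/
theorem IsStdGaussianFamily.mulVec_dist_tail
    (h : IsStdGaussianFamily P fun (p : M × N) ω => Z ω p.1 p.2) {w : N → ℝ} (hw : 0 < w ⬝ᵥ w)
    (V : Submodule ℝ (N → ℝ)) (hV : ∀ u ∈ V, w ⬝ᵥ u = 0) {r : ℕ} (hr : Module.finrank ℝ V ≤ r)
    (a : N → ℝ) {t s : ℝ} (ht : 0 ≤ t) (hs : 0 ≤ s) :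
    P.real {ω | ∃ u ∈ V, (Z ω *ᵥ (a - u)) ⬝ᵥ (Z ω *ᵥ (a - u)) <
        (w ⬝ᵥ a) ^ 2 / (w ⬝ᵥ w) * (Fintype.card M * (1 - t) - s)} ≤
      Real.exp (-(Fintype.card M * t ^ 2 / 4)) + Real.exp ((r + 1) / 2 - s / 4) := by
  have := h.indep.isProbabilityMeasure
  set q := w ⬝ᵥ w with hq
  have hsq : 0 < √q := Real.sqrt_pos.2 hw
  have hsq2 : √q * √q = q := Real.mul_self_sqrt hw.le
  let g : N → ℝ := (√q)⁻¹ • w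
  have hg : g ⬝ᵥ g = 1 := by
    simp only [g, smul_dotProduct, dotProduct_smul, smul_eq_mul]
    rw [← hq]
    field_simp
    rw [Real.sq_sqrt hw.le]
  let K : ℝ := (w ⬝ᵥ a) / √q
  have hK : K ^ 2 = (w ⬝ᵥ a) ^ 2 / q := by
    simp only [K, div_pow, Real.sq_sqrt hw.le]
  let a' : N → ℝ := a - K • g
  have hga' : g ⬝ᵥ a' = 0 := by
    simp only [a', dotProduct_sub, dotProduct_smul, hg]
    simp only [g, K, smul_dotProduct, smul_eq_mul]
    field_simp
    ring
  -- Adjoining a' costs one dimension, but then a - u = K g + (a' - u) with a' - u in a fixed space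
  -- orthogonal to g, for all u in V at once.
  let V' : Submodule ℝ (N → ℝ) := V ⊔ Submodule.span ℝ {a'}
  have hV' : ∀ u ∈ V', g ⬝ᵥ u = 0 := by
    intro u hu
    obtain ⟨v, hv, z, hz, rfl⟩ := Submodule.mem_sup.1 hu
    obtain ⟨x, rfl⟩ := Submodule.mem_span_singleton.1 hz
    rw [dotProduct_add, dotProduct_smul, hga']
    simp only [g, smul_dotProduct, hV v hv]
    simp
  have hr' : Module.finrank ℝ V' ≤ r + 1 := by
    refine (Submodule.finrank_add_le_finrank_add_finrank _ _).trans ?_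
    exact add_le_add hr ((finrank_span_le_card _).trans (by simp))
  have hE1 := (h.mulVec hg).chiSq_lower_tail ht
  have hE2 := h.mulVec_projection_tail hg V' hV' hr' s
  push_cast at hE2
  refine le_trans ?_ (add_le_add hE1 hE2)
  refine le_trans (measureReal_mono ?_ (measure_ne_top _ _)) (measureReal_union_le _ _)
  rintro ω ⟨u, hu, hlt⟩
  by_contra hc
  simp only [Set.mem_union, Set.mem_ofPred_eq, not_or, not_le, not_exists, not_and, not_lt] at hc
  obtain ⟨h1, h2⟩ := hc
  have hmem : a' - u ∈ V' := by
    refine Submodule.sub_mem _ ?_ (Submodule.mem_sup_left hu)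
    exact Submodule.mem_sup_right (Submodule.mem_span_singleton_self _)
  have h3 := h2 _ hmem
  have h4 : Z ω *ᵥ (a - u) = K • (Z ω *ᵥ g) + Z ω *ᵥ (a' - u) := by
    rw [← Matrix.mulVec_smul, ← Matrix.mulVec_add]
    congr 1
    simp only [a']
    abel
  have h5 : ∑ k, (Z ω *ᵥ g) k ^ 2 = (Z ω *ᵥ g) ⬝ᵥ (Z ω *ᵥ g) := by
    simp [dotProduct, sq]
  rw [h5] at h1
  rw [h4, ← hK] at hlt
  simp only [add_dotProduct, dotProduct_add, smul_dotProduct, dotProduct_smul, smul_eq_mul] at hlt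
  rw [dotProduct_comm (Z ω *ᵥ g) (Z ω *ᵥ (a' - u))] at hlt
  have hy : 0 ≤ (Z ω *ᵥ (a' - u)) ⬝ᵥ (Z ω *ᵥ (a' - u)) :=
    Finset.sum_nonneg fun _ _ => mul_self_nonneg _
  generalize (Z ω *ᵥ (a' - u)) ⬝ᵥ (Z ω *ᵥ (a' - u)) = y at *
  generalize (Z ω *ᵥ (a' - u)) ⬝ᵥ (Z ω *ᵥ g) = x at *
  generalize (Z ω *ᵥ g) ⬝ᵥ (Z ω *ᵥ g) = z at *
  have h6 : (K * x) ^ 2 ≤ K ^ 2 * s * y := by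
    rw [mul_pow, mul_assoc]
    exact mul_le_mul_of_nonneg_left h3 (sq_nonneg K)
  have h7 : K ^ 2 * (Fintype.card M * (1 - t)) ≤ K ^ 2 * z :=
    mul_le_mul_of_nonneg_left h1.le (sq_nonneg K)
  have h8 : 0 ≤ K ^ 2 * s := mul_nonneg (sq_nonneg K) hs
  -- AM–GM: the cross term satisfies 2|Kx| ≤ K²s + y, so y cancels and at least K²(z - s) is left.
  have h9 := (abs_le_of_sq_le_sq' (a := 2 * (K * x)) (b := K ^ 2 * s + y)
    (by nlinarith [sq_nonneg (K ^ 2 * s - y)]) (by linarith)).1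
  nlinarith

end RandomMatrix

/-! ### Total effects, their dual vectors, and the witnesses they provide. -/

namespace WeightedDAG

open Matrix Relation

variable {n : ℕ} (G : WeightedDAG n)

theorem mem_parents {i j : Fin n} : j ∈ G.parents i ↔ G.graph.Adj j i := by
  simp [parents]

theorem mem_children {j l : Fin n} : l ∈ G.children j ↔ G.graph.Adj j l := by
  simp [children]

theorem wellFounded_transGen : WellFounded (TransGen G.graph.Adj) :=
  have : Std.Irrefl (TransGen G.graph.Adj) := ⟨G.acyclic⟩
  Finite.wellFounded_of_trans_of_irrefl _

theorem wellFounded_swap_transGen : WellFounded (Function.swap (TransGen G.graph.Adj)) :=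
  have : Std.Irrefl (Function.swap (TransGen G.graph.Adj)) := ⟨G.acyclic⟩
  Finite.wellFounded_of_trans_of_irrefl _

theorem wellFounded_adj : WellFounded G.graph.Adj :=
  Subrelation.wf (fun h => TransGen.single h) G.wellFounded_transGen

/-- Induction along the edges of the graph. -/
theorem induction {p : Fin n → Prop} (h : ∀ i, (∀ j ∈ G.parents i, p j) → p i) (i : Fin n) :
    p i :=
  G.wellFounded_adj.induction i fun i ih => h i fun j hj => ih j (G.mem_parents.1 hj)

/-- The vector of the total effects of all the noise variables on the node `i`. -/
noncomputable def effect : Fin n → Fin n → ℝ :=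
  G.wellFounded_adj.fix fun i ih =>
    Pi.single i 1 + ∑ j ∈ (G.parents i).attach,
      G.weight j i • ih j.1 (G.mem_parents.1 j.2)

theorem effect_eq (i : Fin n) :
    G.effect i = Pi.single i 1 + ∑ j ∈ G.parents i, G.weight j i • G.effect j := by
  rw [effect, WellFounded.fix_eq, ← Finset.sum_attach (G.parents i)]

/-- The solution of the structural equations in terms of the noise. -/
theorem eq_mulVec_effect {M : Type*} {D Z : Matrix M (Fin n) ℝ}
    (h : ∀ k i, D k i = (∑ j ∈ G.parents i, G.weight j i * D k j) + Z k i) (k : M) (i : Fin n) :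
    D k i = (Z *ᵥ G.effect i) k := by
  induction i using G.induction with
  | h i ih =>
    rw [h, G.effect_eq, Matrix.mulVec_add, Matrix.mulVec_sum]
    simp only [Matrix.mulVec_smul, Matrix.mulVec_single_one, Pi.add_apply, Finset.sum_apply,
      Pi.smul_apply, smul_eq_mul, Matrix.col_apply]
    rw [add_comm]
    congr 1
    exact Finset.sum_congr rfl fun j hj => by rw [ih j hj]

/-- The recursion for the effects never leaves a set closed under parents, so noise from outside
cannot enter. -/
theorem effect_eq_zero_of_closed {T : Set (Fin n)} (hT : ∀ i ∈ T, ∀ j ∈ G.parents i, j ∈ T)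
    {i l : Fin n} (hi : i ∈ T) (hl : l ∉ T) : G.effect i l = 0 := by
  induction i using G.induction with
  | h i ih =>
    have hil : l ≠ i := fun h => hl (h ▸ hi)
    rw [G.effect_eq]
    simp only [Pi.add_apply, Pi.single_apply, hil, if_false, Finset.sum_apply, Pi.smul_apply,
      smul_eq_mul, zero_add]
    exact Finset.sum_eq_zero fun j hj => by rw [ih j hj (hT i hi j hj), mul_zero]

theorem effect_eq_zero {i l : Fin n} (h : ¬ ReflTransGen G.graph.Adj l i) : G.effect i l = 0 :=
  G.effect_eq_zero_of_closed (T := {j | ¬ ReflTransGen G.graph.Adj l j})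
    (fun _ hi _ hj hc => hi (hc.tail (G.mem_parents.1 hj))) h (fun hc => hc ReflTransGen.refl)

theorem not_reflTransGen_of_adj {i j : Fin n} (h : G.graph.Adj j i) :
    ¬ ReflTransGen G.graph.Adj i j :=
  fun hc => G.acyclic j (TransGen.head' h hc)

theorem effect_self (i : Fin n) : G.effect i i = 1 := by
  rw [G.effect_eq]
  simp only [Pi.add_apply, Pi.single_eq_same, Finset.sum_apply, Pi.smul_apply, smul_eq_mul]
  rw [Finset.sum_eq_zero, add_zero]
  intro j hj
  rw [G.effect_eq_zero (G.not_reflTransGen_of_adj (G.mem_parents.1 hj)), mul_zero]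

/-- If an ancestrally closed set of nodes misses a node and one of its parents, then some vector
witnesses that the conditional variance of the node given the set exceeds one. -/
theorem exists_orthogonal_of_missing_parent {T : Set (Fin n)}
    (hT : ∀ i ∈ T, ∀ j ∈ G.parents i, j ∈ T) {i : Fin n} (hi : i ∉ T)
    (hp : ∃ p ∈ G.parents i, p ∉ T) :
    ∃ w : Fin n → ℝ, ∃ q ∈ G.parents i, w ⬝ᵥ w = 1 + G.weight q i ^ 2 ∧
      w ⬝ᵥ G.effect i = 1 + G.weight q i ^ 2 ∧ ∀ j ∈ T, w ⬝ᵥ G.effect j = 0 := by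
  -- No other missing parent is a descendant of q, so the noise of q reaches i through the edge q →
  -- i alone and its total effect is exactly that weight.
  obtain ⟨q, ⟨hq, hqT⟩, hmax⟩ := G.wellFounded_swap_transGen.has_min
    {p | p ∈ G.parents i ∧ p ∉ T} hp
  have hqi : q ≠ i := by
    rintro rfl
    exact G.acyclic q (TransGen.single (G.mem_parents.1 hq))
  have heff : G.effect i q = G.weight q i := by
    rw [G.effect_eq]
    simp only [Pi.add_apply, Pi.single_apply, hqi, if_false, Finset.sum_apply, Pi.smul_apply,
      smul_eq_mul, zero_add]
    rw [Finset.sum_eq_single_of_mem q hq, effect_self, mul_one]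
    intro j hj hjq
    by_cases hjT : j ∈ T
    · rw [G.effect_eq_zero_of_closed hT hjT hqT, mul_zero]
    · rw [G.effect_eq_zero, mul_zero]
      intro hc
      rcases reflTransGen_iff_eq_or_transGen.1 hc with h | h
      · exact hjq h
      · exact hmax j ⟨hj, hjT⟩ h
  -- This is the restriction of the effect vector of i to the coordinates i and q, both invisible to
  -- T.
  refine ⟨Pi.single i 1 + G.weight q i • Pi.single q 1, q, hq, ?_, ?_, ?_⟩
  · simp only [add_dotProduct, smul_dotProduct, single_one_dotProduct, Pi.add_apply,
      Pi.single_eq_same, Pi.smul_apply, smul_eq_mul, Pi.single_apply, hqi, hqi.symm, if_false]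
    ring
  · simp only [add_dotProduct, smul_dotProduct, single_one_dotProduct, heff, effect_self,
      smul_eq_mul]
    ring
  · intro j hj
    simp only [add_dotProduct, smul_dotProduct, single_one_dotProduct, smul_eq_mul]
    rw [G.effect_eq_zero_of_closed hT hj hi, G.effect_eq_zero_of_closed hT hj hqT]
    ring

/-- The column of `k` of the matrix that expresses the noise in terms of the variables, up to
transposition. -/
noncomputable def dual (k : Fin n) : Fin n → ℝ :=
  Pi.single k 1 - ∑ l ∈ G.children k, G.weight k l • Pi.single l 1

theorem dual_apply_of_mem {k l : Fin n} (h : l ∈ G.children k) :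
    G.dual k l = -G.weight k l := by
  have hlk : l ≠ k := by
    rintro rfl
    exact G.acyclic l (TransGen.single (G.mem_children.1 h))
  simp [dual, Pi.single_apply, hlk, h]

theorem dual_apply_of_notMem {k l : Fin n} (h : l ∉ G.children k) :
    G.dual k l = if k = l then 1 else 0 := by
  simp [dual, Pi.single_apply, h, eq_comm]

/-- The effects are the rows of the inverse of I - B and the duals are the columns of I - B, where
B_{lk} = b_{kl}; along the recursion the direct weight k → l cancels. -/
theorem dual_dotProduct_effect (k l : Fin n) :
    G.dual k ⬝ᵥ G.effect l = if k = l then 1 else 0 := by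
  induction l using G.induction with
  | h l ih =>
    rw [G.effect_eq, dotProduct_add, dotProduct_sum, dotProduct_single_one]
    have h1 : ∑ j ∈ G.parents l, G.dual k ⬝ᵥ (G.weight j l • G.effect j) =
        if k ∈ G.parents l then G.weight k l else 0 := by
      rw [← Finset.sum_ite_eq (G.parents l) k fun j => G.weight j l]
      refine Finset.sum_congr rfl fun j hj => ?_
      rw [dotProduct_smul, ih j hj]
      split_ifs <;> simp
    rw [h1]
    by_cases hkl : G.graph.Adj k l
    · have hne : k ≠ l := by
        rintro rfl
        exact G.acyclic k (TransGen.single hkl)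
      rw [G.dual_apply_of_mem (G.mem_children.2 hkl), if_pos (G.mem_parents.2 hkl), if_neg hne]
      ring
    · rw [G.dual_apply_of_notMem (mt G.mem_children.1 hkl), if_neg (mt G.mem_parents.1 hkl),
        add_zero]

theorem dual_dotProduct_self (k : Fin n) :
    G.dual k ⬝ᵥ G.dual k = 1 + ∑ l ∈ G.children k, G.weight k l ^ 2 := by
  have hk : k ∉ G.children k := fun h => G.acyclic k (TransGen.single (G.mem_children.1 h))
  have hd : ∀ v : Fin n → ℝ, G.dual k ⬝ᵥ v =
      (Pi.single k 1 - ∑ l ∈ G.children k, G.weight k l • Pi.single l 1) ⬝ᵥ v := fun _ => rfl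
  rw [hd, sub_dotProduct, sum_dotProduct, single_one_dotProduct, G.dual_apply_of_notMem hk,
    if_pos rfl, sub_eq_add_neg, ← Finset.sum_neg_distrib]
  congr 1
  refine Finset.sum_congr rfl fun l hl => ?_
  rw [smul_dotProduct, single_one_dotProduct, G.dual_apply_of_mem hl, smul_eq_mul]
  ring

/-- By biorthogonality this bounds the squared distance of the effect of k from the span of the
other effects below by 1/τ; it is the source of τ in the sample size. -/
theorem dual_dotProduct_self_le_tau (k : Fin n) : G.dual k ⬝ᵥ G.dual k ≤ G.tau := by
  rw [dual_dotProduct_self, tau]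
  have := le_ciSup (f := fun j : Fin n => ∑ l ∈ G.children j, G.weight j l ^ 2)
    (Set.finite_range _).bddAbove k
  simpa using this

theorem one_le_dual_dotProduct_self (k : Fin n) : 1 ≤ G.dual k ⬝ᵥ G.dual k := by
  rw [dual_dotProduct_self]
  exact le_add_of_nonneg_right (Finset.sum_nonneg fun _ _ => sq_nonneg _)

theorem one_le_tau : 1 ≤ G.tau :=
  le_add_of_nonneg_right (Real.iSup_nonneg fun _ => Finset.sum_nonneg fun _ _ => sq_nonneg _)

end WeightedDAG

/-! ### Deterministic correctness of the two phases. -/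

namespace ExhaustiveRegression

open Relation

variable {m n : ℕ} {G : WeightedDAG n} {D : Fin m → Fin n → ℝ} {d : ℕ} {b : ℝ}

/-- Makes the initial variance test the case J = ∅ of the regression test. -/
theorem empVar_eq_mse_ols (D : Fin m → Fin n → ℝ) (i : Fin n) :
    empVar D i = mse D i (ols D i ∅) := by
  have h : ols D i ∅ = 0 := by
    ext j
    exact (ols_isLeastSquares D i ∅).1 j (by simp)
  simp [h, mse, empVar]

/-- The list has no duplicates, and with every node it contains all its parents, in earlier
positions. -/
def IsPartialOrdering (G : WeightedDAG n) (T : List (Fin n)) : Prop :=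
  T.Nodup ∧ ∀ i ∈ T, ∀ j ∈ G.parents i, j ∈ T ∧ T.idxOf j < T.idxOf i

theorem IsPartialOrdering.append {T : List (Fin n)} (hT : IsPartialOrdering G T) {i : Fin n}
    (hi : i ∉ T) (hp : ∀ j ∈ G.parents i, j ∈ T) : IsPartialOrdering G (T ++ [i]) := by
  refine ⟨List.nodup_append.2 ⟨hT.1, by simp, ?_⟩, ?_⟩
  · rintro a ha c hc rfl
    rw [List.mem_singleton] at hc
    exact hi (hc ▸ ha)
  · intro l hl j hj
    rcases List.mem_append.1 hl with hl | hl
    · obtain ⟨h1, h2⟩ := hT.2 l hl j hj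
      rw [List.idxOf_append_of_mem h1, List.idxOf_append_of_mem hl]
      exact ⟨List.mem_append_left _ h1, h2⟩
    · rw [List.mem_singleton] at hl
      subst hl
      have h1 := hp j hj
      rw [List.idxOf_append_of_mem h1, List.idxOf_append_of_notMem hi]
      exact ⟨List.mem_append_left _ h1, (List.idxOf_lt_length_iff.2 h1).trans_le (by simp)⟩

theorem exists_notMem_forall_parents_mem (G : WeightedDAG n) {T : List (Fin n)}
    (h : ∃ i, i ∉ T) : ∃ i, i ∉ T ∧ ∀ j ∈ G.parents i, j ∈ T := by
  obtain ⟨i, hi, hmin⟩ := G.wellFounded_adj.has_min {i | i ∉ T} h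
  refine ⟨i, hi, fun j hj => ?_⟩
  by_contra hc
  exact hmin j hc (G.mem_parents.1 hj)

/-- Deterministic part of the analysis of the first phase: it suffices that the regression on the
parents has a small error, while the regression on a set in the ancestrally closed set `T` has a
large error as long as `T` misses the node and one of its parents. -/
theorem phase1Succeeds_of_mse (hd : ∀ i, (G.parents i).card ≤ d)
    (hsmall : ∀ i, mse D i (ols D i (G.parents i)) ≤ 1 + b ^ 2 / 2)
    (hlarge : ∀ i, ∀ J : Finset (Fin n), J.card ≤ d → ∀ T : Set (Fin n),
      (∀ l ∈ T, ∀ j ∈ G.parents l, j ∈ T) → (∀ j ∈ J, j ∈ T) → i ∉ T →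
      (∃ p ∈ G.parents i, p ∉ T) → 1 + b ^ 2 / 2 < mse D i (ols D i J)) :
    Phase1Succeeds G D d b := by
  rintro T ⟨T₀, ⟨hnd, hinit⟩, hreach⟩
  have h0 : IsPartialOrdering G T₀ := by
    refine ⟨hnd, fun i hi j hj => ?_⟩
    have h1 := (hinit i).1 hi
    rw [empVar_eq_mse_ols] at h1
    -- With J = T = ∅ the large-error hypothesis excludes every node that has a parent, so any order
    -- of the initial list is admissible.
    exact absurd h1 (not_le.2 (hlarge i ∅ (by simp) ∅ (by simp) (by simp) (by simp)
      ⟨j, hj, by simp⟩))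
  have hT : IsPartialOrdering G T := by
    induction hreach with
    | refl => exact h0
    | @tail T₁ _ _ hstep ih =>
      obtain ⟨i, hi, ⟨J, hJ, hJd, hmse⟩, rfl⟩ := hstep
      refine ih.append hi ?_
      by_contra hc
      push Not at hc
      exact absurd hmse (not_le.2 (hlarge i J hJd {l | l ∈ T₁}
        (fun l hl j hj => (ih.2 l hl j hj).1) hJ hi hc))
  constructor
  · intro hlen
    have hex : ∃ i, i ∉ T := by
      by_contra hc
      push Not at hc
      have h1 : T.toFinset = Finset.univ := by
        ext i
        simp [hc i]
      have h2 := List.toFinset_card_le T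
      rw [h1, Finset.card_univ, Fintype.card_fin] at h2
      omega
    obtain ⟨i, hi, hp⟩ := exists_notMem_forall_parents_mem G hex
    exact ⟨T ++ [i], i, hi, ⟨G.parents i, hp, hd i, hsmall i⟩, rfl⟩
  · intro hlen
    have hall : ∀ i, i ∈ T := by
      have h1 : T.toFinset = Finset.univ := by
        rw [← Finset.card_eq_iff_eq_univ, List.toFinset_card_of_nodup hT.1, hlen,
          Fintype.card_fin]
      intro i
      rw [← List.mem_toFinset, h1]
      exact Finset.mem_univ i
    exact ⟨hT.1, hall, fun i j hij => (hT.2 j (hall j) i (G.mem_parents.2 hij)).2⟩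

theorem idxOf_le_of_reflTransGen {T : List (Fin n)} (hT : G.IsTopologicalOrder T) {i j : Fin n}
    (h : ReflTransGen G.graph.Adj i j) : T.idxOf i ≤ T.idxOf j := by
  induction h with
  | refl => exact le_rfl
  | tail _ hadj ih => exact ih.trans (hT.2.2 _ _ hadj).le

/-- Deterministic part of the analysis of the second phase: it suffices that the regression on
every set of non-descendants that contains the parents estimates the weights up to `b / 2`. -/
theorem phase2Succeeds_of_ols (hd : ∀ i, (G.parents i).card ≤ d)
    (hb : ∀ i, ∀ j ∈ G.parents i, b ≤ |G.weight j i|)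
    (hols : ∀ i, ∀ L : Finset (Fin n), L.card ≤ 2 * d →
      (∀ l ∈ L, ¬ ReflTransGen G.graph.Adj i l) → G.parents i ⊆ L →
      ∀ k ∈ L, |ols D i L k - if k ∈ G.parents i then G.weight k i else 0| < b / 2)
    {T : List (Fin n)} (hT : G.IsTopologicalOrder T) : Phase2Succeeds G D d b T := by
  intro i
  set S := before T i with hS
  have hmem : ∀ j, j ∈ S ↔ T.idxOf j < T.idxOf i := by
    intro j
    simp [hS, before]
  have hnd : ∀ l ∈ S, ¬ ReflTransGen G.graph.Adj i l := fun l hl hc =>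
    absurd ((hmem l).1 hl) (not_lt.2 (idxOf_le_of_reflTransGen hT hc))
  have hpS : G.parents i ⊆ S := fun j hj =>
    (hmem j).2 (hT.2.2 _ _ (G.mem_parents.1 hj))
  have hin : ∀ L ⊆ S, L.card ≤ 2 * d → G.parents i ⊆ L → ∀ k ∈ L,
      k ∈ G.parents i → b / 2 ≤ |ols D i L k| := by
    intro L hL hc hp k hk hkp
    have h1 := hols i L hc (fun l hl => hnd l (hL hl)) hp k hk
    rw [if_pos hkp] at h1
    have h2 := hb i k hkp
    have h3 := abs_sub_abs_le_abs_sub (G.weight k i) (ols D i L k)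
    rw [abs_sub_comm] at h3
    linarith
  have hout : ∀ L ⊆ S, L.card ≤ 2 * d → G.parents i ⊆ L → ∀ k ∈ L,
      k ∉ G.parents i → |ols D i L k| < b / 2 := by
    intro L hL hc hp k hk hkp
    have h1 := hols i L hc (fun l hl => hnd l (hL hl)) hp k hk
    rwa [if_neg hkp, sub_zero] at h1
  -- Once J contains the parents, K consists of non-parents, whose estimates stay below the cutoff.
  have hpass : ∀ J ⊆ S, J.card = min S.card d → G.parents i ⊆ J → Passes D d b S i J := by
    rintro J hJ hJc hp K hK hKc ⟨k, hk, hbk⟩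
    have h1 := Finset.mem_sdiff.1 (hK hk)
    refine absurd hbk (not_le.2 (hout (J ∪ K) ?_ ?_ ?_ k ?_ fun h => h1.2 (hp h)))
    · exact Finset.union_subset hJ fun l hl => (Finset.mem_sdiff.1 (hK hl)).1
    · have := Finset.card_union_le J K
      omega
    · exact hp.trans Finset.subset_union_left
    · exact Finset.mem_union_right _ hk
  have hpass' : ∀ J ⊆ S, J.card = min S.card d → Passes D d b S i J → G.parents i ⊆ J := by
    intro J hJ hJc hJp j hj
    by_contra hjJ
    have hsub : G.parents i \ J ⊆ S \ J := Finset.sdiff_subset_sdiff hpS le_rfl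
    have hc1 : (G.parents i \ J).card ≤ d := (Finset.card_le_card Finset.sdiff_subset).trans (hd i)
    have hc2 := Finset.card_le_card hsub
    rw [Finset.card_sdiff_of_subset hJ] at hc2
    -- The missing parents themselves form a K that refutes J; together with J they number at most
    -- 2d.
    refine hJp (G.parents i \ J) hsub (le_min hc2 hc1) ⟨j, Finset.mem_sdiff.2 ⟨hj, hjJ⟩, ?_⟩
    refine hin _ ?_ ?_ ?_ j ?_ hj
    · exact Finset.union_subset hJ (Finset.sdiff_subset.trans hpS)
    · have := Finset.card_union_le J (G.parents i \ J)
      omega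
    · intro l hl
      by_cases hlJ : l ∈ J
      · exact Finset.mem_union_left _ hlJ
      · exact Finset.mem_union_right _ (Finset.mem_sdiff.2 ⟨hl, hlJ⟩)
    · exact Finset.mem_union_right _ (Finset.mem_sdiff.2 ⟨hj, hjJ⟩)
  constructor
  · obtain ⟨J, hpJ, hJS, hJc⟩ := Finset.exists_subsuperset_card_eq hpS
      (le_min (Finset.card_le_card hpS) (hd i)) (min_le_left S.card d)
    exact ⟨_, J, hJS, hJc, hpass J hJS hJc hpJ, rfl⟩
  · rintro Q ⟨J, hJS, hJc, hJp, rfl⟩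
    have hp := hpass' J hJS hJc hJp
    have hJd : J.card ≤ 2 * d := by omega
    ext k
    rw [Finset.mem_filter]
    refine ⟨fun ⟨hk, hbk⟩ => ?_, fun hk => ⟨hp hk, hin J hJS hJd hp k (hp hk) hk⟩⟩
    by_contra hkp
    exact absurd hbk (not_le.2 (hout J hJS hJd hp k hk hkp))

end ExhaustiveRegression

/-! ### Least squares in terms of the noise matrix. -/

namespace WeightedDAG

open Matrix Relation

variable {n : ℕ} (G : WeightedDAG n)

/-- The span of the effect vectors of the nodes of `J`. -/
def effectSpan (J : Finset (Fin n)) : Submodule ℝ (Fin n → ℝ) :=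
  Submodule.span ℝ (G.effect '' J)

theorem finrank_effectSpan_le (J : Finset (Fin n)) :
    Module.finrank ℝ (G.effectSpan J) ≤ J.card := by
  classical
  rw [effectSpan, ← Finset.coe_image]
  exact (finrank_span_finset_le_card _).trans Finset.card_image_le

theorem sum_smul_effect_mem {J : Finset (Fin n)} {β : Fin n → ℝ} (hβ : ∀ j, j ∉ J → β j = 0) :
    ∑ j, β j • G.effect j ∈ G.effectSpan J := by
  refine Submodule.sum_mem _ fun j _ => ?_
  by_cases hj : j ∈ J
  · exact Submodule.smul_mem _ _ (Submodule.subset_span ⟨j, hj, rfl⟩)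
  · rw [hβ j hj, zero_smul]
    exact Submodule.zero_mem _

theorem dotProduct_eq_zero_of_mem_effectSpan {J : Finset (Fin n)} {w : Fin n → ℝ}
    (hw : ∀ j ∈ J, w ⬝ᵥ G.effect j = 0) {u : Fin n → ℝ} (hu : u ∈ G.effectSpan J) :
    w ⬝ᵥ u = 0 := by
  induction hu using Submodule.span_induction with
  | mem x hx =>
    obtain ⟨j, hj, rfl⟩ := hx
    exact hw j hj
  | zero => exact dotProduct_zero _
  | add x y _ _ hx hy => rw [dotProduct_add, hx, hy, add_zero]
  | smul c x _ hx => rw [dotProduct_smul, hx, smul_zero]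

end WeightedDAG

namespace ExhaustiveRegression

open Matrix Relation

variable {m n : ℕ} (G : WeightedDAG n) (Z : Matrix (Fin m) (Fin n) ℝ)

/-- The data that the noise matrix `Z` generates. -/
noncomputable def modelData : Fin m → Fin n → ℝ := fun k j => (Z *ᵥ G.effect j) k

theorem mse_modelData (i : Fin n) (β : Fin n → ℝ) :
    mse (modelData G Z) i β = (1 / (m : ℝ)) *
      ((Z *ᵥ (G.effect i - ∑ j, β j • G.effect j)) ⬝ᵥ
        (Z *ᵥ (G.effect i - ∑ j, β j • G.effect j))) := by
  rw [mse, dotProduct]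
  congr 1
  refine Finset.sum_congr rfl fun k _ => ?_
  rw [← sq, Matrix.mulVec_sub, Matrix.mulVec_sum]
  simp [modelData, Matrix.mulVec_smul]

/-- The vector of the true coefficients for the node `i`. -/
noncomputable def trueCoeff (i : Fin n) : Fin n → ℝ :=
  fun j => if j ∈ G.parents i then G.weight j i else 0

/-- Cancelling the true coefficients against the structural equation writes the residual as the
noise of i minus the combination with the estimation errors. -/
theorem effect_sub_sum_smul (i : Fin n) (β : Fin n → ℝ) :
    G.effect i - ∑ j, β j • G.effect j =
      Pi.single i 1 - ∑ j, (β j - trueCoeff G i j) • G.effect j := by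
  have h : ∑ j, trueCoeff G i j • G.effect j = ∑ j ∈ G.parents i, G.weight j i • G.effect j := by
    simp only [trueCoeff, ite_smul, zero_smul]
    rw [Finset.sum_ite_mem, Finset.univ_inter]
  simp only [sub_smul, Finset.sum_sub_distrib, h]
  rw [G.effect_eq i]
  abel

theorem mse_ols_parents_le (i : Fin n) :
    mse (modelData G Z) i (ols (modelData G Z) i (G.parents i)) ≤
      (1 / (m : ℝ)) * ∑ k, Z k i ^ 2 := by
  refine ((ols_isLeastSquares (modelData G Z) i (G.parents i)).2 (trueCoeff G i) ?_).trans_eq ?_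
  · intro j hj
    exact if_neg hj
  · rw [mse_modelData, effect_sub_sum_smul]
    simp [dotProduct, sq]

variable {G Z}

/-- Least squares estimates are accurate when the noise is almost orthogonal to the regressors
and the regressors are far from being collinear. -/
theorem abs_ols_sub_trueCoeff_lt {i : Fin n} {L : Finset (Fin n)} (hm : 0 < m)
    (hp : G.parents i ⊆ L) {s q c : ℝ} (hs : 0 ≤ s) (hc : 0 < c) (hsq : 4 * s < c ^ 2 * q)
    (hnoise : ∀ u ∈ G.effectSpan L,
      ((Z *ᵥ u) ⬝ᵥ (Z *ᵥ Pi.single i 1)) ^ 2 ≤ s * ((Z *ᵥ u) ⬝ᵥ (Z *ᵥ u)))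
    {k : Fin n} (hdist : ∀ u ∈ G.effectSpan (L.erase k),
      q ≤ (Z *ᵥ (G.effect k - u)) ⬝ᵥ (Z *ᵥ (G.effect k - u))) :
    |ols (modelData G Z) i L k - trueCoeff G i k| < c := by
  have hols := ols_isLeastSquares (modelData G Z) i L
  set β := ols (modelData G Z) i L with hβ
  have h0 : ∀ j, j ∉ L → trueCoeff G i j = 0 := fun j hj => if_neg fun h => hj (hp h)
  set γ : Fin n → ℝ := fun j => β j - trueCoeff G i j with hγ
  have hγ0 : ∀ j, j ∉ L → γ j = 0 := fun j hj => by
    simp only [hγ]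
    rw [hols.1 j hj, h0 j hj, sub_zero]
  set u := ∑ j, γ j • G.effect j with hu
  have huL : u ∈ G.effectSpan L := G.sum_smul_effect_mem hγ0
  have hmse := hols.2 (trueCoeff G i) h0
  rw [mse_modelData, mse_modelData, effect_sub_sum_smul, effect_sub_sum_smul] at hmse
  simp only [sub_self, zero_smul, Finset.sum_const_zero, sub_zero] at hmse
  have hm' : (0 : ℝ) < 1 / m := by positivity
  have h1 := le_of_mul_le_mul_left hmse hm'
  change (Z *ᵥ (Pi.single i 1 - u)) ⬝ᵥ (Z *ᵥ (Pi.single i 1 - u)) ≤ _ at h1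
  rw [Matrix.mulVec_sub] at h1
  simp only [sub_dotProduct, dotProduct_sub] at h1
  rw [dotProduct_comm (Z *ᵥ Pi.single i 1) (Z *ᵥ u)] at h1
  have h2 := hnoise u huL
  have hy : 0 ≤ (Z *ᵥ u) ⬝ᵥ (Z *ᵥ u) := Finset.sum_nonneg fun _ _ => mul_self_nonneg _
  -- Optimality against the true coefficients gives y ≤ 2x, and x² ≤ s y then yields y² ≤ 4 s y.
  have h3 : (Z *ᵥ u) ⬝ᵥ (Z *ᵥ u) ≤ 4 * s := by
    generalize (Z *ᵥ u) ⬝ᵥ (Z *ᵥ u) = y at *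
    generalize (Z *ᵥ u) ⬝ᵥ (Z *ᵥ Pi.single i 1) = x at *
    have h4 : y ≤ 2 * x := by linarith
    rcases hy.eq_or_lt with h5 | h5
    · rw [← h5]
      linarith
    · have h6 : y * y ≤ 4 * s * y := by nlinarith
      exact le_of_mul_le_mul_right h6 h5
  change |γ k| < c
  by_contra hcon
  have hck : c ≤ |γ k| := not_lt.1 hcon
  have hck2 : c ^ 2 ≤ γ k ^ 2 := by
    rw [← sq_abs (γ k)]
    exact pow_le_pow_left₀ hc.le hck 2
  have hne : γ k ≠ 0 := fun h => by
    rw [h, abs_zero] at hck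
    linarith
  -- Dividing the error combination by γ_k leaves the effect of k minus an element of the span of
  -- the others, so y ≥ γ_k² q.
  let v := -∑ j, (if j = k then 0 else (γ k)⁻¹ * γ j) • G.effect j
  have hv : v ∈ G.effectSpan (L.erase k) := by
    refine Submodule.neg_mem _ (G.sum_smul_effect_mem fun j hj => ?_)
    split_ifs with hjk
    · rfl
    · rw [hγ0 j fun h => hj (Finset.mem_erase.2 ⟨hjk, h⟩), mul_zero]
  have huv : u = γ k • (G.effect k - v) := by
    simp only [v, sub_neg_eq_add, smul_add, Finset.smul_sum, smul_smul]
    rw [hu, ← Finset.add_sum_erase _ _ (Finset.mem_univ k),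
      ← Finset.add_sum_erase (a := k) _ (fun j => (γ k * if j = k then 0 else (γ k)⁻¹ * γ j) •
        G.effect j) (Finset.mem_univ k)]
    simp only [if_true, mul_zero, zero_smul, zero_add]
    congr 1
    refine Finset.sum_congr rfl fun j hj => ?_
    rw [if_neg (Finset.ne_of_mem_erase hj), mul_inv_cancel_left₀ hne]
  have h7 := hdist v hv
  rw [huv, Matrix.mulVec_smul, smul_dotProduct, dotProduct_smul, smul_eq_mul, smul_eq_mul] at h3
  have hq : 0 < q := by
    by_contra hq
    have := mul_nonneg (sq_nonneg c) (neg_nonneg.2 (not_lt.1 hq))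
    linarith
  nlinarith [mul_le_mul hck2 h7 hq.le (sq_nonneg (γ k))]

end ExhaustiveRegression

/-! ### Counting and the union bound. -/

/-- The number of pairs of an element and a subset of size at most `2 d` of a set of size `n`. -/
theorem card_mul_card_subsets_le {n d : ℕ} (hd : 1 ≤ d) (hn : 2 * d ≤ n) :
    (n : ℝ) * ((Finset.univ.filter fun J : Finset (Fin n) => J.card ≤ 2 * d).card : ℝ) ≤
      Real.exp (7 * (d * Real.log (n / d))) := by
  have hd0 : (0 : ℝ) < d := by exact_mod_cast hd
  have hn0 : (0 : ℝ) < n := by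
    have : 0 < n := by omega
    exact_mod_cast this
  have hnd : (2 : ℝ) ≤ n / d := by
    rw [le_div_iff₀ hd0]
    exact_mod_cast hn
  have hlog : (1 : ℝ) / 2 ≤ Real.log (n / d) := by
    have := Real.log_le_log (by norm_num) hnd
    linarith [Real.log_two_gt_d9]
  have hH : (d : ℝ) ≤ 2 * (d * Real.log (n / d)) := by nlinarith
  have hn1 : (n : ℝ) ≤ Real.exp (3 * (d * Real.log (n / d))) := by
    rw [← Real.log_le_iff_le_exp hn0]
    have h1 : Real.log n = Real.log (n / d) + Real.log d := by
      rw [Real.log_div hn0.ne' hd0.ne']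
      ring
    have h2 := Real.log_le_sub_one_of_pos hd0
    have h3 : Real.log (n / d) ≤ d * Real.log (n / d) :=
      le_mul_of_one_le_left (by linarith) (by exact_mod_cast hd)
    linarith
  have hN : ((Finset.univ.filter fun J : Finset (Fin n) => J.card ≤ 2 * d).card : ℝ) ≤
      Real.exp (4 * (d * Real.log (n / d))) := by
    -- Weight each J by x^|J|: all subsets together weigh (1 + x)^n ≤ e^d, while each small one
    -- weighs at least x^(2d).
    set x : ℝ := d / n with hx
    have hx0 : 0 < x := by positivity
    have hx1 : x ≤ 1 := by
      rw [hx, div_le_one hn0]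
      have : d ≤ n := by omega
      exact_mod_cast this
    have h1 : ((Finset.univ.filter fun J : Finset (Fin n) => J.card ≤ 2 * d).card : ℝ) *
        x ^ (2 * d) ≤ (x + 1) ^ n := by
      have h2 := Fintype.sum_pow_mul_eq_add_pow (Fin n) x 1
      simp only [one_pow, mul_one, Fintype.card_fin] at h2
      rw [← h2, ← nsmul_eq_mul, ← Finset.sum_const]
      refine (Finset.sum_le_sum fun J hJ => ?_).trans
        (Finset.sum_le_sum_of_subset_of_nonneg (Finset.filter_subset _ _)
          fun J _ _ => pow_nonneg hx0.le _)
      exact pow_le_pow_of_le_one hx0.le hx1 (Finset.mem_filter.1 hJ).2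
    have h3 : (x + 1) ^ n ≤ Real.exp d := by
      refine (pow_le_pow_left₀ (by positivity) (Real.add_one_le_exp x) n).trans_eq ?_
      rw [← Real.exp_nat_mul]
      congr 1
      rw [hx]
      field_simp
    have h4 : x ^ (2 * d) = Real.exp (-(2 * (d * Real.log (n / d)))) := by
      have : x = Real.exp (-Real.log (n / d)) := by
        rw [← Real.log_inv, inv_div, Real.exp_log hx0]
      rw [this, ← Real.exp_nat_mul]
      congr 1
      push_cast
      ring
    rw [h4] at h1
    have h5 := h1.trans h3
    rw [Real.exp_neg, ← div_eq_mul_inv, div_le_iff₀ (Real.exp_pos _), ← Real.exp_add] at h5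
    refine h5.trans (Real.exp_le_exp.2 ?_)
    linarith
  refine (mul_le_mul hn1 hN (Nat.cast_nonneg _) (Real.exp_pos _).le).trans_eq ?_
  rw [← Real.exp_add]
  congr 1
  ring

/-- Union bound over all pairs of a node and a set of at most `2 d` nodes. -/
theorem one_sub_le_measureReal_of_bad {n d : ℕ} (hd : 1 ≤ d) (hn : 2 * d ≤ n) {δ : ℝ}
    (hδ : 0 < δ) (hδ1 : δ < 1) {Ω : Type*} [MeasurableSpace Ω] {P : Measure Ω}
    [IsProbabilityMeasure P] {good : Set Ω} (bad : Fin n → Finset (Fin n) → Set Ω)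
    (hbad : ∀ i J, J.card ≤ 2 * d → P.real (bad i J) ≤
      3 * Real.exp (-(10 * (d * Real.log (n / d) + Real.log (1 / δ)))))
    (hgood : ∀ᵐ ω ∂P, (∀ i J, J.card ≤ 2 * d → ω ∉ bad i J) → ω ∈ good) :
    1 - δ ≤ P.real good := by
  classical
  have hd0 : (0 : ℝ) < d := by exact_mod_cast hd
  have hnd : (2 : ℝ) ≤ n / d := by
    rw [le_div_iff₀ hd0]
    exact_mod_cast hn
  set H : ℝ := d * Real.log (n / d) with hHdef
  have hH : Real.log 2 ≤ H := by
    have h1 := Real.log_le_log (by norm_num) hnd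
    have h2 := Real.log_two_gt_d9
    have h3 : (1 : ℝ) ≤ d := by exact_mod_cast hd
    nlinarith
  have hl : 0 < Real.log (1 / δ) := Real.log_pos (by rw [lt_div_iff₀ hδ]; linarith)
  set Q := (Finset.univ : Finset (Fin n)) ×ˢ
    (Finset.univ.filter fun J : Finset (Fin n) => J.card ≤ 2 * d) with hQ
  set B : Set Ω := ⋃ p ∈ Q, bad p.1 p.2 with hB
  have hPB : P.real B ≤ δ := by
    refine (measureReal_biUnion_finset_le Q _).trans ?_
    refine (Finset.sum_le_card_nsmul Q _ _ fun p hp =>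
      hbad p.1 p.2 (Finset.mem_filter.1 (Finset.mem_product.1 hp).2).2).trans ?_
    rw [nsmul_eq_mul, hQ, Finset.card_product, Finset.card_univ, Fintype.card_fin, Nat.cast_mul]
    have h1 := card_mul_card_subsets_le hd hn
    refine (mul_le_mul_of_nonneg_right h1 (by positivity)).trans ?_
    -- Of the exponent 10 H, counting the pairs consumes 7 H and the factor 3 the remaining 3 H.
    have h3 : (3 : ℝ) ≤ Real.exp (3 * H) := by
      have h4 : Real.exp (3 * Real.log 2) = 8 := by
        rw [mul_comm, Real.exp_mul, Real.exp_log (by norm_num)]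
        norm_num
      have h5 := Real.exp_le_exp.2 (mul_le_mul_of_nonneg_left hH (by norm_num : (0 : ℝ) ≤ 3))
      linarith
    have h6 : Real.exp (-Real.log (1 / δ)) = δ := by
      rw [← Real.log_inv, one_div, inv_inv, Real.exp_log hδ]
    calc Real.exp (7 * H) * (3 * Real.exp (-(10 * (H + Real.log (1 / δ)))))
        ≤ Real.exp (7 * H) * (Real.exp (3 * H) *
          Real.exp (-(10 * (H + Real.log (1 / δ))))) := by gcongr
      _ = Real.exp (-(10 * Real.log (1 / δ))) := by
        rw [← Real.exp_add, ← Real.exp_add]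
        congr 1
        ring
      _ ≤ Real.exp (-Real.log (1 / δ)) := Real.exp_le_exp.2 (by linarith)
      _ = δ := h6
  -- Subadditivity replaces complements, since `good` need not be measurable.
  have h1 : (1 : ℝ) ≤ P.real (B ∪ good) := by
    have h2 : ∀ᵐ ω ∂P, ω ∈ B ∪ good := by
      filter_upwards [hgood] with ω hω
      by_cases h : ω ∈ B
      · exact Or.inl h
      · refine Or.inr (hω fun i J hJ hc => h ?_)
        exact Set.mem_biUnion (x := (i, J)) (by simp [hQ, hJ]) hc
    have h3 : P (B ∪ good) = 1 := by
      rw [← measure_univ (μ := P)]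
      exact measure_congr (Filter.eventuallyEq_univ.2 h2)
    rw [measureReal_def, h3]
    simp
  linarith [measureReal_union_le (μ := P) B good]

/-! ### Probabilities of the bad events. -/

namespace ExhaustiveRegression

open Matrix Relation

variable {m n d : ℕ} (G : WeightedDAG n) {b : ℝ}
  {Ω : Type*} [MeasurableSpace Ω] {P : Measure Ω} {Z : Ω → Matrix (Fin m) (Fin n) ℝ}

theorem measureReal_noise_upper_le
    (h : IsStdGaussianFamily P fun (p : Fin m × Fin n) ω => Z ω p.1 p.2) (i : Fin n)
    {t : ℝ} (ht : 0 ≤ t) (ht1 : t ≤ 1) :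
    P.real {ω | m * (1 + t) ≤ ∑ k, Z ω k i ^ 2} ≤ Real.exp (-(m * t ^ 2 / 16)) := by
  have h1 := (h.mulVec (w := Pi.single i 1) (by simp)).chiSq_upper_tail ht ht1
  simpa using h1

/-- The node `i` and one of its parents lie outside some ancestrally closed set that contains
`J`. -/
def IsMissing (i : Fin n) (J : Finset (Fin n)) : Prop :=
  ∃ T : Set (Fin n), (∀ l ∈ T, ∀ j ∈ G.parents l, j ∈ T) ∧ (∀ j ∈ J, j ∈ T) ∧ i ∉ T ∧
    ∃ p ∈ G.parents i, p ∉ T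

variable {G}

theorem measureReal_small_mse_le
    (h : IsStdGaussianFamily P fun (p : Fin m × Fin n) ω => Z ω p.1 p.2) (hm : 0 < m)
    (hb0 : 0 < b) (hb1 : b ≤ 1) (hb : ∀ i, ∀ j ∈ G.parents i, b ≤ |G.weight j i|)
    {i : Fin n} {J : Finset (Fin n)} (hd : 1 ≤ d) (hJ : J.card ≤ 2 * d)
    (hmiss : IsMissing G i J) :
    P.real {ω | mse (modelData G (Z ω)) i (ols (modelData G (Z ω)) i J) ≤ 1 + b ^ 2 / 2} ≤
      Real.exp (-(m * b ^ 4 / 256)) + Real.exp (2 * d - m * b ^ 2 / 64) := by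
  have := h.indep.isProbabilityMeasure
  -- The event depends on i and J only, so one witness T suffices and no union over closed sets is
  -- needed.
  obtain ⟨T, hT, hJT, hiT, hp⟩ := hmiss
  obtain ⟨w, q, hq, hww, hwi, hwT⟩ := G.exists_orthogonal_of_missing_parent hT hiT hp
  have hbq : b ^ 2 ≤ G.weight q i ^ 2 := by
    rw [← sq_abs (G.weight q i)]
    exact pow_le_pow_left₀ hb0.le (hb i q hq) 2
  have hm0 : (0 : ℝ) < m := by exact_mod_cast hm
  have hw0 : 0 < w ⬝ᵥ w := by
    rw [hww]
    positivity
  -- These t and s lose the factor 1 - 3b²/16 in total, and (1 + b²)(1 - 3b²/16) still exceeds 1 +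
  -- b²/2 for b ≤ 1.
  have hmain := h.mulVec_dist_tail hw0 (G.effectSpan J)
    (fun u hu => G.dotProduct_eq_zero_of_mem_effectSpan (fun j hj => hwT j (hJT j hj)) hu)
    (r := J.card) (G.finrank_effectSpan_le J) (G.effect i) (t := b ^ 2 / 8)
    (s := m * b ^ 2 / 16) (by positivity) (by positivity)
  refine (measureReal_mono ?_ (measure_ne_top _ _)).trans (hmain.trans (add_le_add ?_ ?_))
  · intro ω hω
    refine ⟨_, G.sum_smul_effect_mem (ols_isLeastSquares (modelData G (Z ω)) i J).1, ?_⟩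
    rw [Set.mem_ofPred_eq, mse_modelData, one_div, inv_mul_le_iff₀ hm0] at hω
    refine hω.trans_lt ?_
    have h0 : (1 + G.weight q i ^ 2) ^ 2 / (1 + G.weight q i ^ 2) = 1 + G.weight q i ^ 2 := by
      field_simp
    rw [hwi, hww, Fintype.card_fin, h0]
    have h1 : (m : ℝ) * (1 - b ^ 2 / 8) - m * b ^ 2 / 16 = m * (1 - 3 * b ^ 2 / 16) := by ring
    rw [h1]
    have hb2 : 0 < b ^ 2 := by positivity
    have hb3 : b ^ 2 ≤ 1 := pow_le_one₀ hb0.le hb1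
    have h2 : 1 + b ^ 2 / 2 < (1 + b ^ 2) * (1 - 3 * b ^ 2 / 16) := by nlinarith
    have h3 : (1 + b ^ 2) * (1 - 3 * b ^ 2 / 16) ≤
        (1 + G.weight q i ^ 2) * (1 - 3 * b ^ 2 / 16) :=
      mul_le_mul_of_nonneg_right (by linarith) (by linarith)
    calc (m : ℝ) * (1 + b ^ 2 / 2) < m * ((1 + G.weight q i ^ 2) * (1 - 3 * b ^ 2 / 16)) :=
          mul_lt_mul_of_pos_left (h2.trans_le h3) hm0
      _ = _ := by ring
  · rw [Fintype.card_fin, Real.exp_le_exp]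
    exact le_of_eq (by ring)
  · rw [Real.exp_le_exp]
    have h1 : (J.card : ℝ) ≤ 2 * d := by exact_mod_cast hJ
    have h2 : (1 : ℝ) ≤ d := by exact_mod_cast hd
    linarith

/-- Non-descendants of i do not feel its noise, so their effects are orthogonal to e_i. -/
theorem measureReal_noise_correlation
    (h : IsStdGaussianFamily P fun (p : Fin m × Fin n) ω => Z ω p.1 p.2)
    {i : Fin n} {L : Finset (Fin n)} (hL : L.card ≤ 2 * d)
    (hnd : ∀ l ∈ L, ¬ ReflTransGen G.graph.Adj i l) (s : ℝ) :
    P.real {ω | ∃ u ∈ G.effectSpan L, s * ((Z ω *ᵥ u) ⬝ᵥ (Z ω *ᵥ u)) <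
      ((Z ω *ᵥ u) ⬝ᵥ (Z ω *ᵥ Pi.single i 1)) ^ 2} ≤ Real.exp (d - s / 4) := by
  refine (h.mulVec_projection_tail (w := Pi.single i 1) (by simp) (G.effectSpan L)
    (fun u hu => G.dotProduct_eq_zero_of_mem_effectSpan (fun l hl => ?_) hu)
    ((G.finrank_effectSpan_le L).trans hL) s).trans_eq ?_
  · rw [single_one_dotProduct, G.effect_eq_zero (hnd l hl)]
  · push_cast
    congr 1
    ring

theorem measureReal_collinear_le
    (h : IsStdGaussianFamily P fun (p : Fin m × Fin n) ω => Z ω p.1 p.2)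
    (hd : 1 ≤ d) {k : Fin n} {L : Finset (Fin n)} (hL : L.card ≤ 2 * d) (hk : k ∉ L) :
    P.real {ω | ∃ u ∈ G.effectSpan L, (Z ω *ᵥ (G.effect k - u)) ⬝ᵥ (Z ω *ᵥ (G.effect k - u)) <
      m / (2 * G.tau)} ≤ Real.exp (-(m / 64)) + Real.exp (2 * d - m / 16) := by
  have := h.indep.isProbabilityMeasure
  have h1 := G.one_le_dual_dotProduct_self k
  -- The witness is the dual vector; t and s each cost a quarter, which leaves m/(2τ).
  have hmain := h.mulVec_dist_tail (w := G.dual k) (by linarith) (G.effectSpan L)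
    (fun u hu => G.dotProduct_eq_zero_of_mem_effectSpan (fun l hl => by
      rw [G.dual_dotProduct_effect, if_neg fun hkl : k = l => hk (hkl ▸ hl)]) hu)
    (r := L.card) (G.finrank_effectSpan_le L) (G.effect k) (t := 1 / 4)
    (s := m / 4) (by positivity) (by positivity)
  refine (measureReal_mono ?_ (measure_ne_top _ _)).trans (hmain.trans (add_le_add ?_ ?_))
  · rintro ω ⟨u, hu, hlt⟩
    refine ⟨u, hu, hlt.trans_le ?_⟩
    rw [G.dual_dotProduct_effect, if_pos rfl, Fintype.card_fin]
    have h2 : (1 : ℝ) ^ 2 / (G.dual k ⬝ᵥ G.dual k) * (m * (1 - 1 / 4) - m / 4) =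
        m / (2 * (G.dual k ⬝ᵥ G.dual k)) := by
      field_simp
      ring
    rw [h2]
    have h3 := G.dual_dotProduct_self_le_tau k
    gcongr
  · rw [Fintype.card_fin, Real.exp_le_exp]
    exact le_of_eq (by ring)
  · rw [Real.exp_le_exp]
    have h1 : (L.card : ℝ) ≤ 2 * d := by exact_mod_cast hL
    have h2 : (1 : ℝ) ≤ d := by exact_mod_cast hd
    linarith

theorem natCast_le_two_mul_log {n d : ℕ} (hd : 1 ≤ d) (hn : 2 * d ≤ n) :
    (d : ℝ) ≤ 2 * (d * Real.log (n / d)) := by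
  have hd0 : (0 : ℝ) < d := by exact_mod_cast hd
  have hnd : (2 : ℝ) ≤ n / d := by
    rw [le_div_iff₀ hd0]
    exact_mod_cast hn
  have := Real.log_le_log (by norm_num) hnd
  have := Real.log_two_gt_d9
  nlinarith

theorem one_sub_le_measureReal_phase1 [IsProbabilityMeasure P]
    (h : IsStdGaussianFamily P fun (p : Fin m × Fin n) ω => Z ω p.1 p.2)
    {D : Ω → Fin m → Fin n → ℝ} (hD : ∀ᵐ ω ∂P, D ω = modelData G (Z ω))
    (hd : 1 ≤ d) (hn : 2 * d ≤ n) (hpar : ∀ i, (G.parents i).card ≤ d)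
    (hb0 : 0 < b) (hb1 : b ≤ 1) (hb : ∀ i, ∀ j ∈ G.parents i, b ≤ |G.weight j i|)
    {δ : ℝ} (hδ : 0 < δ) (hδ1 : δ < 1)
    (hmC : 2560 * (1 / b ^ 4) * (d * Real.log (n / d) + Real.log (1 / δ)) ≤ m) :
    1 - δ ≤ P.real {ω | Phase1Succeeds G (D ω) d b} := by
  have hH := natCast_le_two_mul_log hd hn
  have hd1 : (1 : ℝ) ≤ d := by exact_mod_cast hd
  have hl : 0 < Real.log (1 / δ) := Real.log_pos (by rw [lt_div_iff₀ hδ]; linarith)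
  set H : ℝ := d * Real.log (n / d) with hHdef
  set Λ : ℝ := H + Real.log (1 / δ) with hΛ
  have hΛ0 : 0 < Λ := by linarith
  have hb2 : 0 < b ^ 2 := by positivity
  have hb4 : 0 < b ^ 4 := by positivity
  have hb42 : b ^ 4 ≤ b ^ 2 := pow_le_pow_of_le_one hb0.le hb1 (by norm_num)
  have hm4 : 2560 * Λ ≤ m * b ^ 4 := by
    rw [mul_one_div, div_mul_eq_mul_div, div_le_iff₀ hb4] at hmC
    exact hmC
  have hm2 : 2560 * Λ ≤ m * b ^ 2 :=
    hm4.trans (mul_le_mul_of_nonneg_left hb42 (Nat.cast_nonneg _))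
  have hm0 : (0 : ℝ) < m := by
    by_contra hc
    have := mul_nonneg (neg_nonneg.2 (not_lt.1 hc)) hb4.le
    linarith
  have hm : 0 < m := by exact_mod_cast hm0
  refine one_sub_le_measureReal_of_bad hd hn hδ hδ1
    (fun i J => {ω | m * (1 + b ^ 2 / 2) ≤ ∑ k, Z ω k i ^ 2} ∪ {ω | IsMissing G i J ∧
      mse (modelData G (Z ω)) i (ols (modelData G (Z ω)) i J) ≤ 1 + b ^ 2 / 2}) ?_ ?_
  · intro i J hJ
    have h1 := measureReal_noise_upper_le h i (t := b ^ 2 / 2) (by positivity) (by nlinarith)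
    have h1' : Real.exp (-(m * (b ^ 2 / 2) ^ 2 / 16)) ≤ Real.exp (-(10 * Λ)) :=
      Real.exp_le_exp.2 (by nlinarith)
    have h2 : P.real {ω | IsMissing G i J ∧
        mse (modelData G (Z ω)) i (ols (modelData G (Z ω)) i J) ≤ 1 + b ^ 2 / 2} ≤
        Real.exp (-(10 * Λ)) + Real.exp (-(10 * Λ)) := by
      by_cases hmiss : IsMissing G i J
      · simp only [hmiss, true_and]
        refine (measureReal_small_mse_le h hm hb0 hb1 hb hd hJ hmiss).trans (add_le_add ?_ ?_)
        · exact Real.exp_le_exp.2 (by linarith)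
        · exact Real.exp_le_exp.2 (by linarith)
      · simp only [hmiss, false_and, Set.ofPred_false, measureReal_empty]
        positivity
    refine (measureReal_union_le _ _).trans ?_
    linarith
  · filter_upwards [hD] with ω hω hgood
    simp only [Set.mem_union, Set.mem_ofPred_eq, not_or, not_le, not_and] at hgood
    rw [hω]
    refine phase1Succeeds_of_mse hpar (fun i => ?_) fun i J hJ T hT hJT hiT hp =>
      (hgood i J (by omega)).2 ⟨T, hT, hJT, hiT, hp⟩
    refine (mse_ols_parents_le G (Z ω) i).trans ?_
    rw [one_div, inv_mul_le_iff₀ hm0]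
    exact (hgood i ∅ (by simp)).1.le

theorem one_sub_le_measureReal_phase2 [IsProbabilityMeasure P]
    (h : IsStdGaussianFamily P fun (p : Fin m × Fin n) ω => Z ω p.1 p.2)
    {D : Ω → Fin m → Fin n → ℝ} (hD : ∀ᵐ ω ∂P, D ω = modelData G (Z ω))
    (hd : 1 ≤ d) (hn : 2 * d ≤ n) (hpar : ∀ i, (G.parents i).card ≤ d)
    (hb0 : 0 < b) (hb1 : b ≤ 1) (hb : ∀ i, ∀ j ∈ G.parents i, b ≤ |G.weight j i|)
    {δ : ℝ} (hδ : 0 < δ) (hδ1 : δ < 1)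
    (hmC : 2560 * (G.tau / b ^ 2) * (d * Real.log (n / d) + Real.log (1 / δ)) ≤ m) :
    1 - δ ≤ P.real {ω | ∀ T : List (Fin n), G.IsTopologicalOrder T →
      Phase2Succeeds G (D ω) d b T} := by
  have hH := natCast_le_two_mul_log hd hn
  have hd1 : (1 : ℝ) ≤ d := by exact_mod_cast hd
  have hl : 0 < Real.log (1 / δ) := Real.log_pos (by rw [lt_div_iff₀ hδ]; linarith)
  set H : ℝ := d * Real.log (n / d) with hHdef
  set Λ : ℝ := H + Real.log (1 / δ) with hΛ
  have hΛ0 : 0 < Λ := by linarith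
  have hτ := G.one_le_tau
  have hτ0 : 0 < G.tau := by linarith
  have hb2 : 0 < b ^ 2 := by positivity
  have hb2' : b ^ 2 ≤ 1 := pow_le_one₀ hb0.le hb1
  have hm2 : 2560 * G.tau * Λ ≤ m * b ^ 2 := by
    rw [← mul_div_assoc, div_mul_eq_mul_div, div_le_iff₀ hb2] at hmC
    exact hmC
  have hm1 : 2560 * Λ ≤ m := by
    have h1 : (m : ℝ) * b ^ 2 ≤ m * 1 := mul_le_mul_of_nonneg_left hb2' (Nat.cast_nonneg _)
    nlinarith
  have hm : 0 < m := by
    have : (0 : ℝ) < m := by linarith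
    exact_mod_cast this
  refine one_sub_le_measureReal_of_bad hd hn hδ hδ1
    -- The index i is the response in the first event and a regressor in the second, used with L
    -- minus that regressor. Neither event mentions T, so all topological orders are covered at
    -- once.
    (fun i L => {ω | (∀ l ∈ L, ¬ ReflTransGen G.graph.Adj i l) ∧
        ∃ u ∈ G.effectSpan L, 48 * Λ * ((Z ω *ᵥ u) ⬝ᵥ (Z ω *ᵥ u)) <
          ((Z ω *ᵥ u) ⬝ᵥ (Z ω *ᵥ Pi.single i 1)) ^ 2} ∪
      {ω | i ∉ L ∧ ∃ u ∈ G.effectSpan L,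
        (Z ω *ᵥ (G.effect i - u)) ⬝ᵥ (Z ω *ᵥ (G.effect i - u)) < m / (2 * G.tau)}) ?_ ?_
  · intro i L hL
    refine (measureReal_union_le _ _).trans ?_
    have h1 : P.real {ω | (∀ l ∈ L, ¬ ReflTransGen G.graph.Adj i l) ∧
        ∃ u ∈ G.effectSpan L, 48 * Λ * ((Z ω *ᵥ u) ⬝ᵥ (Z ω *ᵥ u)) <
          ((Z ω *ᵥ u) ⬝ᵥ (Z ω *ᵥ Pi.single i 1)) ^ 2} ≤ Real.exp (-(10 * Λ)) := by
      by_cases hnd : ∀ l ∈ L, ¬ ReflTransGen G.graph.Adj i l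
      · simp only [eq_true hnd, true_and]
        refine (measureReal_noise_correlation h hL hnd _).trans ?_
        exact Real.exp_le_exp.2 (by linarith)
      · simp only [eq_false hnd, false_and, Set.ofPred_false, measureReal_empty]
        positivity
    have h2 : P.real {ω | i ∉ L ∧ ∃ u ∈ G.effectSpan L,
        (Z ω *ᵥ (G.effect i - u)) ⬝ᵥ (Z ω *ᵥ (G.effect i - u)) < m / (2 * G.tau)} ≤
        Real.exp (-(10 * Λ)) + Real.exp (-(10 * Λ)) := by
      by_cases hi : i ∉ L
      · simp only [eq_true hi, true_and]
        refine (measureReal_collinear_le h hd hL hi).trans (add_le_add ?_ ?_)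
        · exact Real.exp_le_exp.2 (by linarith)
        · exact Real.exp_le_exp.2 (by linarith)
      · simp only [eq_false hi, false_and, Set.ofPred_false, measureReal_empty]
        positivity
    linarith
  · filter_upwards [hD] with ω hω hgood
    simp only [Set.mem_union, Set.mem_ofPred_eq, not_or, not_exists, not_and, not_lt] at hgood
    rw [hω]
    intro T hT
    refine phase2Succeeds_of_ols hpar hb (fun i L hL hnd hp k hk => ?_) hT
    -- With s = 48Λ the noise event has probability at most exp(d - 12Λ) ≤ exp(-10Λ), as d ≤ 2Λ;
    -- accuracy b/2 then needs m b² > 1536 τ Λ.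
    refine abs_ols_sub_trueCoeff_lt hm hp (s := 48 * Λ) (q := m / (2 * G.tau)) (by positivity)
      (by positivity) ?_ ((hgood i L hL).1 hnd)
      ((hgood k (L.erase k) ((Finset.card_erase_le).trans hL)).2 (Finset.notMem_erase k L))
    rw [mul_div_assoc', lt_div_iff₀ (by positivity)]
    nlinarith [mul_pos hτ0 hΛ0]

end ExhaustiveRegression

theorem mainTheorem1 :
    ∃ C : ℝ, 0 < C ∧
      ∀ (n d m : ℕ) (G : WeightedDAG n) (b δ : ℝ)
        (Ω : Type*) [MeasurableSpace Ω] (P : Measure Ω) [IsProbabilityMeasure P]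
        (X : Fin m → Fin n → Ω → ℝ),
        1 ≤ d → 2 * d ≤ n →
        (∀ i, (G.parents i).card ≤ d) →
        0 < b → b ≤ 1 →
        (∀ i, ∀ j ∈ G.parents i, b ≤ |G.weight j i|) →
        0 < δ → δ < 1 →
        G.IsSample P X →
        (C * (1 / b ^ 4) * (d * Real.log (n / d) + Real.log (1 / δ)) ≤ m →
          1 - δ ≤ P.real
            {ω | ExhaustiveRegression.Phase1Succeeds G (fun k i => X k i ω) d b}) ∧
        (C * (G.tau / b ^ 2) * (d * Real.log (n / d) + Real.log (1 / δ)) ≤ m →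
          1 - δ ≤ P.real
            {ω | ∀ T : List (Fin n), G.IsTopologicalOrder T →
              ExhaustiveRegression.Phase2Succeeds G (fun k i => X k i ω) d b T}) := by
  -- 2560 = 10 · 256 turns the exponent m b⁴/256 of the first phase into 10Λ; the other estimates
  -- need less.
  refine ⟨2560, by norm_num, ?_⟩
  intro n d m G b δ Ω _ P _ X hd hn hpar hb0 hb1 hb hδ hδ1 ⟨ε, hind, hlaw, hX⟩
  let Z : Ω → Matrix (Fin m) (Fin n) ℝ := fun ω => Matrix.of fun k i => ε k i ω
  have hZ : IsStdGaussianFamily P fun (p : Fin m × Fin n) ω => Z ω p.1 p.2 :=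
    ⟨hind, fun p => hlaw p.1 p.2⟩
  have hD : ∀ᵐ ω ∂P, (fun k i => X k i ω) = ExhaustiveRegression.modelData G (Z ω) := by
    filter_upwards [hX] with ω hω
    funext k i
    exact G.eq_mulVec_effect (D := fun k i => X k i ω) (Z := Z ω) hω k i
  exact ⟨ExhaustiveRegression.one_sub_le_measureReal_phase1 hZ hD hd hn hpar hb0 hb1 hb hδ hδ1,
    ExhaustiveRegression.one_sub_le_measureReal_phase2 hZ hD hd hn hpar hb0 hb1 hb hδ hδ1⟩
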